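/- Model. Let $U_\theta$ ($\theta\in\mathbb R$) be a smooth family of unitaries on $\mathbb C^d\otimes\mathbb C^k$ (system $\otimes$ noise unit), let $\chi\in\mathbb C^k$ be a unit vector and $P_\chi=|\chi\rangle\langle\chi|$, and fix $\theta_0\in\mathbb R$. Let $K_i=\langle i|U_{\theta_0}|\chi\rangle$ and $\dot K_i=\langle i|\dot U_{\theta_0}|\chi\rangle$ ($i=1,\dots,k$), where dots denote $d/d\theta$ at $\theta_0$. Assume that the transition operator $T(\rho)=\mathrm{Tr}_u\big(U_{\theta_0}(\rho\otimes P_\chi)U_{\theta_0}^*\big)=\sum_iK_i\rho K_i^*$ is primitive: it has a unique stationary state $\rho_{ss}$, $\rho_{ss}$ has full rank, and $1$ is the only eigenvalue of $T$ of modulus one. Absorber. Let $V$ be a unitary on $\mathbb C^d\otimes\mathbb C^k$ (absorber $\otimes$ noise unit) and put $W_\theta=VU_\theta$ on $\mathbb C^d\otimes\mathbb C^d\otimes\mathbb C^k$ (system, absorber, noise unit), $W=W_{\theta_0}$, $\dot W=\dot W_{\theta_0}$. Let $\psi\in\mathbb C^d\otimes\mathbb C^d$ be a unit vector with $W(\psi\otimes\chi)=\psi\otimes\chi$.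 Assume that the chain of system + absorber is ergodic at $\theta_0$, i.e. $|\psi\rangle\langle\psi|$ is the only stationary state of $\sigma\mapsto\mathrm{Tr}_u\big(W(\sigma\otimes P_\chi)W^*\big)$, and that the phase of $U_\theta$ is chosen so that $\langle\psi\otimes\chi|\dot W|\psi\otimes\chi\rangle=0$. Let $|\Psi_\theta(n)\rangle=W_\theta^{(n)}\cdots W_\theta^{(1)}|\psi\otimes\chi^{\otimes n}\rangle$, where $W_\theta^{(j)}$ acts on system, absorber and the $j$-th noise unit, and let $F(n)$ be the quantum Fisher information of $\theta\mapsto|\Psi_\theta(n)\rangle\langle\Psi_\theta(n)|$ at $\theta_0$. Measurement. Put $A_1=\dot W|\psi\otimes\chi\rangle\langle\psi\otimes\chi|W^*-W|\psi\otimes\chi\rangle\langle\psi\otimes\chi|\dot W^*$. An optimal adaptive output measurement measures the units $j=1,2,\dots$ successively, with outcomes $i_1,i_2,\dots$; the $j$-th unit is measured in an orthonormal basis $\{e^{[j]}_i\}_{i=1}^k$ of $\mathbb C^k$, which may depend on $i_1,\dots,i_{j-1}$ and satisfies, for all $i$ and all previous outcomes, $$\langle e^{[j]}_i|\,\mathrm{Tr}_{s+a}A_j\,|e^{[j]}_i\rangle=0,\qquad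 |\langle e^{[j]}_i|\chi\rangle|^2=\frac1k ,$$ where for $j\ge2$ $$A_j=\frac1{k^{\,j-1}}A_1+W\big(\Pi_{j-1}\otimes P_\chi\big)W^*,\qquad \Pi_j=\langle e^{[j]}_{i_j}|A_j|e^{[j]}_{i_j}\rangle\quad (j\ge 1).$$ Let $I^{(o)}(n)=\sum_{\mathbf i:\,p_{\theta_0}(\mathbf i)>0}\dot p_{\theta_0}(\mathbf i)^2/p_{\theta_0}(\mathbf i)$ be the classical Fisher information at $\theta_0$ of the first $n$ outcomes, where $p_\theta(i_1,\dots,i_n)=\big\|\langle e^{[1]}_{i_1}\otimes\cdots\otimes e^{[n]}_{i_n}|\Psi_\theta(n)\rangle\big\|^2$. Claim. There is a constant $c$, depending only on the model ($U_\theta$, $\theta_0$, $\chi$ and the absorber $V$, $\psi$), but neither on $n$ nor on the choice of the optimal adaptive measurement, such that $$F(n)-I^{(o)}(n)<c\qquad\text{for all } n .$$ Moreover, for every optimal adaptive measurement, $$\lim_{n\to\infty}\frac1nI^{(o)}(n)=\lim_{n\to\infty}\frac1nF(n)=f,$$ $$f=4\sum_{i=1}^k\Big[\mathrm{Tr}\big(\rho_{ss}\dot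 K_i^*\dot K_i\big)+2\,\mathrm{Tr}\Big(\mathrm{Im}\big(K_i\rho_{ss}\dot K_i^*\big)\,\mathcal R\big(\mathrm{Im}\textstyle\sum_j\dot K_j^*K_j\big)\Big)\Big],$$ where $\mathrm{Im}X=(X-X^*)/2i$ and $\mathcal R$ is the Moore–Penrose inverse (for the Hilbert–Schmidt inner product) of $\mathrm{Id}-T^*$, $T^*(X)=\sum_iK_i^*XK_i$. The limit of $F(n)/n$ does not depend on any measurement. Finally $f\ge0$, and $f>0$ unless the sequence $F(n)$ is bounded. -/

import Mathlib

open Filter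
open scoped Matrix Kronecker Topology ContDiff ComplexOrder

namespace QMC

noncomputable section

/-! ### States, partial traces, the Markov transition operator -/

/-- Density matrices on a finite-dimensional space with a fixed orthonormal basis. -/
def IsState {ι : Type} [Fintype ι] (ρ : Matrix ι ι ℂ) : Prop :=
  ρ.PosSemidef ∧ ρ.trace = 1

/-- Unit vectors. -/
def IsUnitVec {ι : Type} [Fintype ι] (v : ι → ℂ) : Prop := star v ⬝ᵥ v = 1

/-- The rank-one operator `|v⟩⟨v|`. -/
def proj {ι : Type} (v : ι → ℂ) : Matrix ι ι ℂ := Matrix.vecMulVec v (star v)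

/-- The product vector `v ⊗ w`. -/
def tens {ι κ : Type} (v : ι → ℂ) (w : κ → ℂ) : ι × κ → ℂ := fun x => v x.1 * w x.2

/-- Partial trace over the second tensor factor. -/
def traceSnd {ι κ : Type} [Fintype κ] (M : Matrix (ι × κ) (ι × κ) ℂ) : Matrix ι ι ℂ :=
  Matrix.of fun s t => ∑ u, M (s, u) (t, u)

/-- Partial trace over the first tensor factor. -/
def traceFst {ι κ : Type} [Fintype ι] (M : Matrix (ι × κ) (ι × κ) ℂ) : Matrix κ κ ℂ :=
  Matrix.of fun u w => ∑ s, M (s, u) (s, w)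

/-- The partial matrix element `⟨e| M |e⟩` with respect to a vector `e` of the second factor. -/
def sandwich {ι κ : Type} [Fintype κ] (e : κ → ℂ) (M : Matrix (ι × κ) (ι × κ) ℂ) :
    Matrix ι ι ℂ :=
  Matrix.of fun s t => ∑ u, ∑ w, star (e u) * M (s, u) (t, w) * e w

/-- The Kraus operators `K_i = ⟨i| U |χ⟩`. -/
def kraus {ι κ : Type} [Fintype κ] (U : Matrix (ι × κ) (ι × κ) ℂ) (χ : κ → ℂ) (i : κ) :
    Matrix ι ι ℂ :=
  Matrix.of fun s t => ∑ u, U (s, i) (t, u) * χ u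

/-- The transition operator `T(ρ) = Tr_u (U (ρ ⊗ |χ⟩⟨χ|) U*)`. -/
def transition {ι κ : Type} [Fintype ι] [Fintype κ]
    (U : Matrix (ι × κ) (ι × κ) ℂ) (χ : κ → ℂ) : Module.End ℂ (Matrix ι ι ℂ) where
  toFun ρ := traceSnd (U * (ρ ⊗ₖ proj χ) * Uᴴ)
  map_add' ρ σ := by
    ext s t
    simp [traceSnd, Matrix.add_kronecker, Matrix.mul_add, Matrix.add_mul, Finset.sum_add_distrib]
  map_smul' c ρ := by
    ext s t
    simp [traceSnd, Matrix.smul_kronecker, Finset.mul_sum]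

/-- The dual (Heisenberg picture) transition operator `X ↦ ∑ i, K_i* X K_i`, the adjoint of
`transition U χ` for the Hilbert-Schmidt inner product. -/
def dualTransition {ι κ : Type} [Fintype ι] [Fintype κ]
    (U : Matrix (ι × κ) (ι × κ) ℂ) (χ : κ → ℂ) : Module.End ℂ (Matrix ι ι ℂ) where
  toFun X := ∑ i, (kraus U χ i)ᴴ * X * kraus U χ i
  map_add' X Y := by simp [Matrix.mul_add, Matrix.add_mul, Finset.sum_add_distrib]
  map_smul' c X := by simp [Finset.smul_sum]

/-- `ρ` is the only stationary state of `T`. -/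
def IsUniqueStationaryState {ι : Type} [Fintype ι] (T : Module.End ℂ (Matrix ι ι ℂ))
    (ρ : Matrix ι ι ℂ) : Prop :=
  IsState ρ ∧ T ρ = ρ ∧ ∀ σ, IsState σ → T σ = σ → σ = ρ

/-- `T` is primitive with stationary state `ρ`: `ρ` is the unique stationary state, it has full
rank, and `T` is aperiodic. -/
def IsPrimitive {ι : Type} [Fintype ι] (T : Module.End ℂ (Matrix ι ι ℂ))
    (ρ : Matrix ι ι ℂ) : Prop :=
  IsUniqueStationaryState T ρ ∧ ρ.PosDef ∧ ∀ μ : ℂ, ‖μ‖ = 1 → T.HasEigenvalue μ → μ = 1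

/-! ### Fisher informations -/

/-- Entrywise derivative of a matrix-valued function. -/
def matDeriv {ι : Type} (M : ℝ → Matrix ι ι ℂ) (θ₀ : ℝ) : Matrix ι ι ℂ :=
  Matrix.of fun a b => deriv (fun θ => M θ a b) θ₀

/-- `L` is a symmetric logarithmic derivative of the model `ρ` at `θ₀`:
`dρ/dθ = (L ρ + ρ L) / 2`. -/
def IsSLD {ι : Type} [Fintype ι] (ρ : ℝ → Matrix ι ι ℂ) (θ₀ : ℝ) (L : Matrix ι ι ℂ) : Prop :=
  L.IsHermitian ∧ ∀ a b,
    HasDerivAt (fun θ => ρ θ a b) ((1 / 2 : ℂ) * (L * ρ θ₀ + ρ θ₀ * L) a b) θ₀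

open Classical in
/-- The quantum Fisher information `Tr (ρ L²)`, with `L` a symmetric logarithmic derivative. -/
def qfi {ι : Type} [Fintype ι] (ρ : ℝ → Matrix ι ι ℂ) (θ₀ : ℝ) : ℝ :=
  if h : ∃ L, IsSLD ρ θ₀ L then (ρ θ₀ * (h.choose * h.choose)).trace.re else 0

/-- The quantum Fisher information does not depend on the chosen logarithmic derivative. -/
theorem qfi_eq {ι : Type} [Fintype ι] {ρ : ℝ → Matrix ι ι ℂ} {θ₀ : ℝ} {L : Matrix ι ι ℂ}
    (hL : IsSLD ρ θ₀ L) : qfi ρ θ₀ = (ρ θ₀ * (L * L)).trace.re := by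
  have h : ∃ L, IsSLD ρ θ₀ L := ⟨L, hL⟩
  rw [qfi, dif_pos h]
  obtain ⟨L', hL', e⟩ : ∃ L', IsSLD ρ θ₀ L' ∧ h.choose = L' := ⟨_, h.choose_spec, rfl⟩
  rw [e]
  have key : L' * ρ θ₀ + ρ θ₀ * L' = L * ρ θ₀ + ρ θ₀ * L := by
    ext a b
    have := (hL'.2 a b).unique (hL.2 a b)
    simpa using this
  have h1 := congrArg (fun X => (X * L').trace) key
  have h2 := congrArg (fun X => (X * L).trace) key
  simp only [Matrix.add_mul, Matrix.trace_add] at h1 h2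
  have a1 : (L' * ρ θ₀ * L').trace = (ρ θ₀ * (L' * L')).trace := by
    rw [Matrix.mul_assoc, Matrix.trace_mul_comm, Matrix.mul_assoc]
  have a2 : (L * ρ θ₀ * L).trace = (ρ θ₀ * (L * L)).trace := by
    rw [Matrix.mul_assoc, Matrix.trace_mul_comm, Matrix.mul_assoc]
  have a3 : (L * ρ θ₀ * L').trace = (ρ θ₀ * (L' * L)).trace := by
    rw [Matrix.mul_assoc, Matrix.trace_mul_comm, Matrix.mul_assoc]
  have a4 : (L' * ρ θ₀ * L).trace = (ρ θ₀ * (L * L')).trace := by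
    rw [Matrix.mul_assoc, Matrix.trace_mul_comm, Matrix.mul_assoc]
  rw [a1, a3, Matrix.mul_assoc, Matrix.mul_assoc] at h1
  rw [a2, a4, Matrix.mul_assoc, Matrix.mul_assoc] at h2
  have : (ρ θ₀ * (L' * L')).trace = (ρ θ₀ * (L * L)).trace := by
    linear_combination (1 / 2 : ℂ) * h1 + (1 / 2 : ℂ) * h2
  rw [this]

/-- The classical Fisher information of a finite statistical model; the sum runs over the outcomes
of positive probability. -/
def cfi {ι : Type} [Fintype ι] (p : ℝ → ι → ℝ) (θ₀ : ℝ) : ℝ :=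
  ∑ i with 0 < p θ₀ i, (p θ₀ i)⁻¹ * (deriv (fun θ => p θ i) θ₀) ^ 2

/-! ### The output of a quantum Markov chain -/

/-- The joint state `W⁽ⁿ⁾ ⋯ W⁽¹⁾ (φ ⊗ χ^{⊗ n})` of the system and the first `n` noise units:
`W⁽ⁿ⁺¹⁾` acts on the system and on the fresh unit `n + 1`. -/
def totalState {ι κ : Type} [Fintype ι] [Fintype κ] (W : Matrix (ι × κ) (ι × κ) ℂ)
    (φ : ι → ℂ) (χ : κ → ℂ) : (n : ℕ) → ι × (Fin n → κ) → ℂ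
  | 0 => fun x => φ x.1
  | n + 1 => fun x => ∑ t, ∑ w,
      W (x.1, x.2 (Fin.last n)) (t, w) * (totalState W φ χ n (t, Fin.init x.2) * χ w)

/-- The unitary `W = V U` of system + absorber + noise unit, with `U` acting on system and unit
and `V` on absorber and unit. -/
def doubled {d k : ℕ} (V U : Matrix (Fin d × Fin k) (Fin d × Fin k) ℂ) :
    Matrix ((Fin d × Fin d) × Fin k) ((Fin d × Fin d) × Fin k) ℂ :=
  (Matrix.of fun x y => if x.1.1 = y.1.1 then V (x.1.2, x.2) (y.1.2, y.2) else 0) *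
    (Matrix.of fun x y => if x.1.2 = y.1.2 then U (x.1.1, x.2) (y.1.1, y.2) else 0)

/-! ### Adaptive measurements -/

/-- An adaptive sequential measurement of the noise units: `E n h` is the orthonormal basis in which
unit `n + 1` is measured when the first `n` outcomes are `h 0, …, h (n - 1)`. -/
abbrev Scheme (k : ℕ) : Type :=
  (n : ℕ) → (Fin n → Fin k) → OrthonormalBasis (Fin k) ℂ (EuclideanSpace ℂ (Fin k))

/-- The coordinates of the `i`-th vector of the basis `E n h`. -/
def Scheme.vec {k : ℕ} (E : Scheme k) (n : ℕ) (h : Fin n → Fin k) (i : Fin k) : Fin k → ℂ :=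
  fun u => E n h i u

/-- The product vector `e_{i_1} ⊗ ⋯ ⊗ e_{i_n}` belonging to the measurement record `i`. -/
def Scheme.prodVec {k : ℕ} (E : Scheme k) (n : ℕ) (i : Fin n → Fin k) : (Fin n → Fin k) → ℂ :=
  fun f => ∏ j : Fin n, E.vec j (fun l : Fin j => i (Fin.castLE j.isLt.le l)) (i j) (f j)

/-- The probability of the record `i` when the output units of the joint state `Ψ` are measured. -/
def outputProb {ι : Type} [Fintype ι] {k n : ℕ} (E : Scheme k)
    (Ψ : ι × (Fin n → Fin k) → ℂ) (i : Fin n → Fin k) : ℝ :=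
  ∑ s, ‖∑ f, star (E.prodVec n i f) * Ψ (s, f)‖ ^ 2

section MeasurementFilter

variable {ι : Type} [Fintype ι] {k : ℕ}

/-- `A_1 = Ẇ |ψ⊗χ⟩⟨ψ⊗χ| W* - W |ψ⊗χ⟩⟨ψ⊗χ| Ẇ*`. -/
def filterInit (W W' : Matrix (ι × Fin k) (ι × Fin k) ℂ) (ψ : ι → ℂ) (χ : Fin k → ℂ) :
    Matrix (ι × Fin k) (ι × Fin k) ℂ :=
  W' * proj (tens ψ χ) * Wᴴ - W * proj (tens ψ χ) * W'ᴴ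

/-- `A_{n+1} = k^{-n} A_1 + W (Π_n ⊗ |χ⟩⟨χ|) W*`, in terms of the filter operator `Π_n`. -/
def filterStep (W W' : Matrix (ι × Fin k) (ι × Fin k) ℂ) (ψ : ι → ℂ) (χ : Fin k → ℂ)
    (n : ℕ) (P : Matrix ι ι ℂ) : Matrix (ι × Fin k) (ι × Fin k) ℂ :=
  ((k : ℂ) ^ n)⁻¹ • filterInit W W' ψ χ + W * (P ⊗ₖ proj χ) * Wᴴ

/-- The measurement filter `Π_n` after the record `h` of length `n`: `Π_0 = 0` and
`Π_{n+1} = ⟨e_{i}| A_{n+1} |e_{i}⟩`, where `e_i` is the outcome vector of unit `n + 1`. -/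
def filterOp (W W' : Matrix (ι × Fin k) (ι × Fin k) ℂ) (ψ : ι → ℂ) (χ : Fin k → ℂ)
    (E : Scheme k) : (n : ℕ) → (Fin n → Fin k) → Matrix ι ι ℂ
  | 0, _ => 0
  | n + 1, h => sandwich (E.vec n (Fin.init h) (h (Fin.last n)))
      (filterStep W W' ψ χ n (filterOp W W' ψ χ E n (Fin.init h)))

/-- `E` is an optimal adaptive measurement: with `B_{n+1} = Tr_{s+a} A_{n+1}`, every vector `e` of
the basis used at step `n + 1` satisfies `⟨e| B_{n+1} |e⟩ = 0` and `|⟨e|χ⟩|² = 1 / k`. -/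
def IsOptimalScheme (W W' : Matrix (ι × Fin k) (ι × Fin k) ℂ) (ψ : ι → ℂ) (χ : Fin k → ℂ)
    (E : Scheme k) : Prop :=
  ∀ (n : ℕ) (h : Fin n → Fin k) (i : Fin k),
    star (E.vec n h i) ⬝ᵥ
        (traceFst (filterStep W W' ψ χ n (filterOp W W' ψ χ E n h)) *ᵥ E.vec n h i) = 0 ∧
      ‖star (E.vec n h i) ⬝ᵥ χ‖ ^ 2 = 1 / (k : ℝ)

end MeasurementFilter

/-- The quantum Fisher information `F(n)` at `θ₀` of the joint pure state of system, absorber and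
`n` output units. -/
def totalQFI {d k : ℕ} (U : ℝ → Matrix (Fin d × Fin k) (Fin d × Fin k) ℂ)
    (V : Matrix (Fin d × Fin k) (Fin d × Fin k) ℂ) (ψ : Fin d × Fin d → ℂ) (χ : Fin k → ℂ)
    (θ₀ : ℝ) (n : ℕ) : ℝ :=
  qfi (fun θ => proj (totalState (doubled V (U θ)) ψ χ n)) θ₀

/-- The classical Fisher information `I⁽ᵒ⁾(n)` at `θ₀` of the outcomes of the measurement `E` of
the `n` output units. -/
def outputCFI {d k : ℕ} (U : ℝ → Matrix (Fin d × Fin k) (Fin d × Fin k) ℂ)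
    (V : Matrix (Fin d × Fin k) (Fin d × Fin k) ℂ) (ψ : Fin d × Fin d → ℂ) (χ : Fin k → ℂ)
    (E : Scheme k) (θ₀ : ℝ) (n : ℕ) : ℝ :=
  cfi (fun θ => outputProb E (totalState (doubled V (U θ)) ψ χ n)) θ₀

/-! ### The rate -/

/-- The imaginary part `(X - X*) / 2i` of an operator. -/
def imPart {ι : Type} (X : Matrix ι ι ℂ) : Matrix ι ι ℂ :=
  (1 / (2 * Complex.I)) • (X - Xᴴ)

/-- `R` is the Moore-Penrose inverse of the superoperator `S`, for the Hilbert-Schmidt inner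
product `⟨X, Y⟩ = Tr (X* Y)`. -/
def IsMoorePenrose {ι : Type} [Fintype ι] (S R : Module.End ℂ (Matrix ι ι ℂ)) : Prop :=
  S * R * S = S ∧ R * S * R = R ∧
    (∀ X Y : Matrix ι ι ℂ, (((S * R) X)ᴴ * Y).trace = (Xᴴ * (S * R) Y).trace) ∧
    (∀ X Y : Matrix ι ι ℂ, (((R * S) X)ᴴ * Y).trace = (Xᴴ * (R * S) Y).trace)

/-- The rate `4 ∑ i [Tr (ρ K̇_i* K̇_i) + 2 Tr (Im (K_i ρ K̇_i*) R (Im ∑ j K̇_j* K_j))]`. -/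
def qfiRate {d k : ℕ} (U U' : Matrix (Fin d × Fin k) (Fin d × Fin k) ℂ) (χ : Fin k → ℂ)
    (ρ : Matrix (Fin d) (Fin d) ℂ) (R : Module.End ℂ (Matrix (Fin d) (Fin d) ℂ)) : ℝ :=
  4 * ∑ i, ((ρ * ((kraus U' χ i)ᴴ * kraus U' χ i)).trace.re +
    2 * (imPart (kraus U χ i * ρ * (kraus U' χ i)ᴴ) *
      R (imPart (∑ j, (kraus U' χ j)ᴴ * kraus U χ j))).trace.re)

end

end QMC

/-! Let x_n be the joint state at θ₀ and y_n its θ-derivative. The phase convention makes y_n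
orthogonal to x_n, so F(n) = 4‖y_n‖² (`qfi_proj`). Since W fixes ψ ⊗ χ, an optimal measurement finds
system and absorber in α ψ after every record, with |α|² = k^{-n}. The filter operator is the
commutator-like combination |ŷ⟩⟨x̂| − |x̂⟩⟨ŷ| of the conditioned amplitudes of y_n and x_n
(`filterOp_eq`). Its vanishing trace makes ⟨x̂|ŷ⟩ real, and Parseval then gives I(n) = 4‖(⟨ψ| ⊗ 1)
y_n‖² (`cfi_outputProb`). Hence F − I is four times the squared norm of the part of y_n orthogonal
to ψ, whichever optimal measurement is used.

That part is bounded. It obeys y_{n+1} = b_{n+1} + step y_n with a drive b of constant norm, and a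
step maps ψ ⊗ ξ to a vector of the same kind, so the orthogonal part evolves on its own. Uniqueness
of the stationary state and the mean ergodic theorem provide a fixed number of steps that halves it
(`exists_nrm_perp_stepIter_le`, `exists_nrm_perp_le`).

For the rate, ‖y_{n+1}‖² − ‖y_n‖² = a + 2 Re Tr(B η_n), where a = ∑ Tr(ρ_ss K̇_i* K̇_i), B = ∑ K̇_i*
K_i and η_n is the system marginal of |y_n⟩⟨x_n|. The absorber drops out of marginals by unitarity
(`traceSnd_crossMap_doubled`), so η_{n+1} = Y + T η_n with Y = ∑ K̇_i ρ_ss K_i*. The operator B is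
anti-Hermitian with zero stationary mean, so it lies in the range of Id − T*; inverting with R and
telescoping gives F(n) = n f + O(1) (`exists_sum_re_trace_sub_le`). Both limits and f ≥ 0 follow,
and f = 0 would bound F. -/

namespace QMC

set_option linter.unusedSectionVars false

/-! ### Mean ergodic theorem for maps with a unique stationary state -/

section Ergodic

variable {ι : Type} [Fintype ι]

/-- Cesàro means of the orbit of `X`. -/
noncomputable def cesaro (T : Module.End ℂ (Matrix ι ι ℂ)) (X : Matrix ι ι ℂ) (n : ℕ) :
    Matrix ι ι ℂ :=
  ((n : ℂ) + 1)⁻¹ • ∑ m ∈ Finset.range (n + 1), (T ^ m) X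

theorem posSemidef_proj (v : ι → ℂ) : (proj v).PosSemidef :=
  Matrix.posSemidef_vecMulVec_self_star v

theorem trace_proj (v : ι → ℂ) : (proj v).trace = star v ⬝ᵥ v := by
  simp [proj, Matrix.trace, Matrix.vecMulVec_apply, dotProduct, mul_comm]

theorem star_dotProduct_self_eq (v : ι → ℂ) :
    star v ⬝ᵥ v = ((∑ i, ‖v i‖ ^ 2 : ℝ) : ℂ) := by
  simp [dotProduct, Complex.conj_mul']

open scoped MatrixOrder in
-- Write σ = B*B. The diagonal entries are squared column norms of B, each at most the trace 1, and
-- the arithmetic-geometric mean inequality on two columns bounds the remaining entries.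
theorem IsState.norm_apply_le [DecidableEq ι] {σ : Matrix ι ι ℂ} (h : IsState σ) (i j : ι) :
    ‖σ i j‖ ≤ 1 := by
  have hd : ∀ i, 0 ≤ (σ i i).re := fun i => (Complex.le_def.1 h.1.diag_nonneg).1
  have hi : ∀ i, ((σ i i).re : ℂ) = σ i i := fun i => by
    have := (Complex.le_def.1 (h.1.diag_nonneg (i := i))).2
    apply Complex.ext <;> simp_all
  have htr : ∑ i, (σ i i).re = 1 := by
    have := congrArg Complex.re h.2
    simpa [Matrix.trace] using this
  have hle : ∀ i, (σ i i).re ≤ 1 := fun i => by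
    rw [← htr]
    exact Finset.single_le_sum (f := fun i => (σ i i).re) (fun i _ => hd i) (Finset.mem_univ i)
  obtain ⟨B, hB⟩ := CStarAlgebra.nonneg_iff_eq_star_mul_self.mp h.1.nonneg
  rw [Matrix.star_eq_conjTranspose] at hB
  have hdiag : ∀ i, ∑ l, ‖B l i‖ ^ 2 ≤ 1 := fun i => by
    have h1 : σ i i = ((∑ l, ‖B l i‖ ^ 2 : ℝ) : ℂ) := by
      rw [hB]; simp [Matrix.mul_apply, Complex.conj_mul']
    have := hle i
    rw [h1, Complex.ofReal_re] at this
    exact this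
  have h2 : ‖σ i j‖ ≤ ∑ l, ‖B l i‖ * ‖B l j‖ := by
    rw [hB, Matrix.mul_apply]
    refine (norm_sum_le _ _).trans (le_of_eq ?_)
    simp
  have h3 : ∑ l, ‖B l i‖ * ‖B l j‖ ≤ ∑ l, (‖B l i‖ ^ 2 + ‖B l j‖ ^ 2) / 2 :=
    Finset.sum_le_sum fun l _ => by nlinarith [sq_nonneg (‖B l i‖ - ‖B l j‖)]
  rw [← Finset.sum_div, Finset.sum_add_distrib] at h3
  linarith [hdiag i, hdiag j]

theorem isCompact_setOf_isState [DecidableEq ι] : IsCompact {σ : Matrix ι ι ℂ | IsState σ} := by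
  have hK : IsCompact ((Set.pi Set.univ fun _ : ι => Set.pi Set.univ fun _ : ι =>
      Metric.closedBall (0 : ℂ) 1) : Set (Matrix ι ι ℂ)) :=
    isCompact_univ_pi fun _ => isCompact_univ_pi fun _ => isCompact_closedBall _ _
  refine hK.of_isClosed_subset ?_ ?_
  · have h1 : IsClosed {σ : Matrix ι ι ℂ | σ.IsHermitian} := by
      apply isClosed_eq (by fun_prop) continuous_id
    have h2 : IsClosed {σ : Matrix ι ι ℂ | ∀ x : ι → ℂ, 0 ≤ star x ⬝ᵥ (σ *ᵥ x)} := by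
      simp only [Set.ofPred_forall]
      exact isClosed_iInter fun x => isClosed_le continuous_const (by fun_prop)
    have h3 : IsClosed {σ : Matrix ι ι ℂ | σ.trace = 1} :=
      isClosed_eq (by fun_prop) continuous_const
    have e : {σ : Matrix ι ι ℂ | IsState σ} = {σ : Matrix ι ι ℂ | σ.IsHermitian} ∩
        {σ | ∀ x : ι → ℂ, 0 ≤ star x ⬝ᵥ (σ *ᵥ x)} ∩ {σ | σ.trace = 1} := by
      refine Set.ext fun σ => ?_
      simp [IsState, Matrix.posSemidef_iff_dotProduct_mulVec]
    rw [e]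
    exact (h1.inter h2).inter h3
  · intro σ h
    simp only [Set.mem_pi, Set.mem_univ, Metric.mem_closedBall, dist_zero_right, forall_const]
    exact fun i j => IsState.norm_apply_le h i j

theorem proj_mem_span_isState (v : ι → ℂ) :
    proj v ∈ Submodule.span ℂ {σ : Matrix ι ι ℂ | IsState σ} := by
  by_cases hv : star v ⬝ᵥ v = 0
  · have : v = 0 := dotProduct_star_self_eq_zero.1 hv
    subst this
    have : proj (0 : ι → ℂ) = 0 := by ext; simp [proj, Matrix.vecMulVec_apply]
    rw [this]
    exact Submodule.zero_mem _
  · have h : proj v = (star v ⬝ᵥ v) • ((star v ⬝ᵥ v)⁻¹ • proj v) := by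
      rw [smul_smul, mul_inv_cancel₀ hv, one_smul]
    rw [h]
    refine Submodule.smul_mem _ _ (Submodule.subset_span ⟨(posSemidef_proj v).smul ?_, ?_⟩)
    · rw [star_dotProduct_self_eq, ← Complex.ofReal_inv, Complex.zero_le_real]
      positivity
    · rw [Matrix.trace_smul, trace_proj, smul_eq_mul, inv_mul_cancel₀ hv]

/-- Polarization writes every matrix unit as a combination of four rank-one operators |v⟩⟨v|.
Statements linear in X thereby reduce to states. -/
theorem span_isState [DecidableEq ι] :
    Submodule.span ℂ {σ : Matrix ι ι ℂ | IsState σ} = ⊤ := by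
  rw [eq_top_iff]
  intro X _
  rw [Matrix.matrix_eq_sum_single X]
  refine Submodule.sum_mem _ fun i _ => Submodule.sum_mem _ fun j _ => ?_
  have h : Matrix.single i j (X i j) = (X i j / 4) •
      (proj (Pi.single i 1 + Pi.single j 1) - proj (Pi.single i 1 - Pi.single j 1)
        + Complex.I • proj (Pi.single i 1 + Complex.I • Pi.single j 1)
        - Complex.I • proj (Pi.single i 1 - Complex.I • Pi.single j 1)) := by
    have e : ∀ v w : ι → ℂ, Matrix.vecMulVec v (star w) = (1 / 4 : ℂ) •
      (proj (v + w) - proj (v - w) + Complex.I • proj (v + Complex.I • w)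
        - Complex.I • proj (v - Complex.I • w)) := by
      intro v w
      ext a b
      simp only [proj, Matrix.vecMulVec_apply, Matrix.smul_apply, Matrix.sub_apply,
        Matrix.add_apply, Pi.star_apply, Pi.add_apply, Pi.sub_apply, Pi.smul_apply, smul_eq_mul,
        star_add, star_sub, star_mul', Complex.star_def, Complex.conj_I]
      linear_combination (v a * (starRingEnd ℂ) (w b) / 2
        - w a * (starRingEnd ℂ) (v b) / 2) * Complex.I_sq
    have h1 : Matrix.single i j (X i j) =
        X i j • Matrix.vecMulVec (Pi.single i 1) (star (Pi.single j (1 : ℂ))) := by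
      ext a b
      simp only [Matrix.single_apply, Matrix.smul_apply, Matrix.vecMulVec_apply, Pi.star_apply,
        Pi.single_apply, smul_eq_mul]
      by_cases ha : i = a <;> by_cases hb : j = b <;> simp [ha, hb, eq_comm]
    rw [h1, e, smul_smul]
    congr 1
    ring
  rw [h]
  refine Submodule.smul_mem _ _ (Submodule.sub_mem _ (Submodule.add_mem _ (Submodule.sub_mem _
    ?_ ?_) (Submodule.smul_mem _ _ ?_)) (Submodule.smul_mem _ _ ?_)) <;>
  exact proj_mem_span_isState _

variable {T : Module.End ℂ (Matrix ι ι ℂ)} {ρ : Matrix ι ι ℂ}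

theorem IsState.pow_apply (hT : ∀ σ, IsState σ → IsState (T σ)) {σ : Matrix ι ι ℂ}
    (h : IsState σ) (n : ℕ) : IsState ((T ^ n) σ) := by
  induction n with
  | zero => simpa using h
  | succ n ih => rw [pow_succ']; exact hT _ ih

theorem IsState.cesaro (hT : ∀ σ, IsState σ → IsState (T σ)) {σ : Matrix ι ι ℂ}
    (h : IsState σ) (n : ℕ) : IsState (cesaro T σ n) := by
  have hn : ((n : ℂ) + 1) ≠ 0 := by exact_mod_cast n.succ_ne_zero
  refine ⟨Matrix.PosSemidef.smul (Matrix.posSemidef_sum _ fun m _ => (h.pow_apply hT m).1) ?_, ?_⟩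
  · have : ((n : ℂ) + 1)⁻¹ = (((n : ℝ) + 1)⁻¹ : ℝ) := by push_cast; rfl
    rw [this, Complex.zero_le_real]
    positivity
  · rw [QMC.cesaro, Matrix.trace_smul, Matrix.trace_sum,
      Finset.sum_congr rfl fun m _ => (h.pow_apply hT m).2]
    simp [hn]

theorem exists_norm_pow_apply_le [DecidableEq ι] (hT : ∀ σ, IsState σ → IsState (T σ))
    (X : Matrix ι ι ℂ) : ∃ C : ℝ, ∀ n i j, ‖(T ^ n) X i j‖ ≤ C := by
  have hX : X ∈ Submodule.span ℂ {σ : Matrix ι ι ℂ | IsState σ} := by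
    rw [span_isState]; trivial
  induction hX using Submodule.span_induction with
  | mem σ h => exact ⟨1, fun n i j => (IsState.pow_apply hT h n).norm_apply_le i j⟩
  | zero => exact ⟨0, by simp⟩
  | add X Y _ _ hX hY =>
    obtain ⟨C, hC⟩ := hX
    obtain ⟨D, hD⟩ := hY
    refine ⟨C + D, fun n i j => ?_⟩
    rw [map_add, Matrix.add_apply]
    exact (norm_add_le _ _).trans (add_le_add (hC n i j) (hD n i j))
  | smul a X _ hX =>
    obtain ⟨C, hC⟩ := hX
    refine ⟨‖a‖ * C, fun n i j => ?_⟩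
    rw [map_smul, Matrix.smul_apply, norm_smul]
    exact mul_le_mul_of_nonneg_left (hC n i j) (norm_nonneg _)

/-- The difference telescopes to (T^{n+1} σ − σ)/(n + 1), whose numerator has entries bounded by 2.
-/
theorem tendsto_map_cesaro_sub [DecidableEq ι] (hT : ∀ σ, IsState σ → IsState (T σ))
    {σ : Matrix ι ι ℂ} (h : IsState σ) :
    Tendsto (fun n => T (cesaro T σ n) - cesaro T σ n) atTop (𝓝 0) := by
  have e : ∀ n, T (cesaro T σ n) - cesaro T σ n =
      ((n : ℂ) + 1)⁻¹ • ((T ^ (n + 1)) σ - σ) := by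
    intro n
    rw [cesaro, map_smul, ← smul_sub, map_sum, ← Finset.sum_sub_distrib]
    congr 1
    have : ∀ m, T ((T ^ m) σ) = (T ^ (m + 1)) σ := fun m => by rw [pow_succ']; rfl
    simp only [this]
    rw [Finset.sum_range_sub (fun m => (T ^ m) σ)]
    simp
  simp only [e]
  refine tendsto_pi_nhds.2 fun i => ?_
  refine tendsto_pi_nhds.2 fun j => ?_
  have h0 : Tendsto (fun n : ℕ => ((n : ℝ) + 1)⁻¹ * 2) atTop (𝓝 0) := by
    simpa using (tendsto_one_div_add_atTop_nhds_zero_nat (𝕜 := ℝ)).mul_const 2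
  refine squeeze_zero_norm (fun n => ?_) h0
  rw [Matrix.smul_apply, norm_smul]
  have : ‖((n : ℂ) + 1)⁻¹‖ = ((n : ℝ) + 1)⁻¹ := by
    rw [norm_inv]
    norm_cast
  rw [this]
  refine mul_le_mul_of_nonneg_left ?_ (by positivity)
  rw [Matrix.sub_apply]
  refine (norm_sub_le _ _).trans ?_
  linarith [(h.pow_apply hT (n + 1)).norm_apply_le i j, h.norm_apply_le i j]

/-- The means stay in the compact set of states, and every cluster point is stationary, hence equal
to ρ; a sequence in a compact set with only one cluster point converges. -/
theorem IsState.tendsto_cesaro [DecidableEq ι] (hT : ∀ σ, IsState σ → IsState (T σ))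
    (hρ : IsUniqueStationaryState T ρ) {σ : Matrix ι ι ℂ} (h : IsState σ) :
    Tendsto (QMC.cesaro T σ) atTop (𝓝 ρ) := by
  have hTc : Continuous T := T.continuous_of_finiteDimensional
  refine isCompact_setOf_isState.tendsto_nhds_of_unique_mapClusterPt
    (Eventually.of_forall fun n => IsState.cesaro hT h n) fun τ hτ hcl => ?_
  refine hρ.2.2 τ hτ ?_
  have h1 : MapClusterPt (T τ - τ) atTop (fun n => T (QMC.cesaro T σ n) - QMC.cesaro T σ n) :=
    MapClusterPt.continuousAt_comp (f := fun X => T X - X)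
      (hTc.sub continuous_id).continuousAt hcl
  have h2 : (T τ - τ) = 0 := by
    have := (tendsto_map_cesaro_sub hT h)
    exact eq_of_nhds_neBot ((h1.neBot).mono (inf_le_inf le_rfl this))
  exact sub_eq_zero.1 h2

theorem tendsto_cesaro [DecidableEq ι] (hT : ∀ σ, IsState σ → IsState (T σ))
    (hρ : IsUniqueStationaryState T ρ) (X : Matrix ι ι ℂ) :
    Tendsto (cesaro T X) atTop (𝓝 (X.trace • ρ)) := by
  have hX : X ∈ Submodule.span ℂ {σ : Matrix ι ι ℂ | IsState σ} := by
    rw [span_isState]; trivial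
  induction hX using Submodule.span_induction with
  | mem σ h => rw [h.2, one_smul]; exact IsState.tendsto_cesaro hT hρ h
  | zero =>
    have : cesaro T 0 = fun _ => 0 := by ext; simp [cesaro]
    rw [this]
    simp
  | add X Y _ _ hX hY =>
    have : cesaro T (X + Y) = fun n => cesaro T X n + cesaro T Y n := by
      funext n; simp [cesaro, Finset.sum_add_distrib]
    rw [this, Matrix.trace_add, add_smul]
    exact hX.add hY
  | smul a X _ hX =>
    have : cesaro T (a • X) = fun n => a • cesaro T X n := by
      funext n; simp [cesaro, Finset.smul_sum, smul_comm a]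
    rw [this, Matrix.trace_smul, smul_assoc]
    exact hX.const_smul a

/-- Uniqueness among states is upgraded to a one-dimensional fixed space of operators: a fixed X is
its own Cesàro mean. -/
theorem eq_trace_smul_of_fixed [DecidableEq ι] (hT : ∀ σ, IsState σ → IsState (T σ))
    (hρ : IsUniqueStationaryState T ρ) {X : Matrix ι ι ℂ} (hX : T X = X) : X = X.trace • ρ := by
  have h1 : ∀ n, (T ^ n) X = X := fun n => by
    induction n with
    | zero => simp
    | succ n ih => rw [pow_succ', Module.End.mul_apply, ih, hX]
  have h2 : cesaro T X = fun _ => X := by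
    funext n
    have hn : ((n : ℂ) + 1) ≠ 0 := by exact_mod_cast n.succ_ne_zero
    simp only [cesaro, h1, Finset.sum_const, Finset.card_range]
    rw [← Nat.cast_smul_eq_nsmul ℂ, smul_smul]
    push_cast
    rw [inv_mul_cancel₀ hn, one_smul]
  have h3 := tendsto_cesaro hT hρ X
  rw [h2] at h3
  exact tendsto_nhds_unique tendsto_const_nhds h3

end Ergodic

/-! ### Kraus families, one time step, reduced operators -/

section Kraus

variable {ι κ : Type} [Fintype ι] [Fintype κ]

/-- The map `X ↦ ∑ i, K_i X L_i*`. -/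
noncomputable def crossMap (K L : κ → Matrix ι ι ℂ) : Module.End ℂ (Matrix ι ι ℂ) where
  toFun X := ∑ i, K i * X * (L i)ᴴ
  map_add' X Y := by simp [Matrix.mul_add, Matrix.add_mul, Finset.sum_add_distrib]
  map_smul' c X := by simp [Finset.smul_sum]

theorem crossMap_apply (K L : κ → Matrix ι ι ℂ) (X : Matrix ι ι ℂ) :
    crossMap K L X = ∑ i, K i * X * (L i)ᴴ := rfl

theorem trace_crossMap (K L : κ → Matrix ι ι ℂ) (X : Matrix ι ι ℂ) :
    (crossMap K L X).trace = ((∑ i, (L i)ᴴ * K i) * X).trace := by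
  rw [crossMap_apply, Matrix.trace_sum, Finset.sum_mul, Matrix.trace_sum]
  refine Finset.sum_congr rfl fun i _ => ?_
  rw [Matrix.trace_mul_comm, Matrix.mul_assoc]

theorem crossMap_conjTranspose (K L : κ → Matrix ι ι ℂ) (X : Matrix ι ι ℂ) :
    (crossMap K L X)ᴴ = crossMap L K Xᴴ := by
  simp [crossMap_apply, Matrix.conjTranspose_sum, Matrix.mul_assoc]

theorem crossMap_posSemidef (K : κ → Matrix ι ι ℂ) {X : Matrix ι ι ℂ} (hX : X.PosSemidef) :
    (crossMap K K X).PosSemidef :=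
  Matrix.posSemidef_sum _ fun i _ => hX.mul_mul_conjTranspose_same (K i)

theorem mul_kronecker_proj_mul_apply (A B : Matrix (ι × κ) (ι × κ) ℂ) (χ : κ → ℂ)
    (X : Matrix ι ι ℂ) (s t : ι) (i j : κ) :
    (A * (X ⊗ₖ proj χ) * Bᴴ) (s, i) (t, j) = (kraus A χ i * X * (kraus B χ j)ᴴ) s t := by
  simp only [Matrix.mul_apply, Fintype.sum_prod_type, Matrix.kroneckerMap_apply, proj,
    Matrix.vecMulVec_apply, kraus, Matrix.of_apply, Matrix.conjTranspose_apply, Pi.star_apply,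
    Finset.sum_mul, Finset.mul_sum, star_sum, star_mul']
  refine Finset.sum_congr rfl fun a _ => ?_
  rw [Finset.sum_comm]
  conv_rhs => rw [Finset.sum_comm]
  exact Finset.sum_congr rfl fun b _ => Finset.sum_congr rfl fun x _ =>
    Finset.sum_congr rfl fun y _ => by ring

theorem transition_eq_crossMap (U : Matrix (ι × κ) (ι × κ) ℂ) (χ : κ → ℂ) :
    transition U χ = crossMap (kraus U χ) (kraus U χ) := by
  ext X s t
  change (∑ i, (U * (X ⊗ₖ proj χ) * Uᴴ) (s, i) (t, i)) = _
  rw [crossMap_apply, Matrix.sum_apply]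
  exact Finset.sum_congr rfl fun i _ => mul_kronecker_proj_mul_apply U U χ X s t i i

theorem IsState.crossMap [DecidableEq ι] {K : κ → Matrix ι ι ℂ} (hK : ∑ i, (K i)ᴴ * K i = 1)
    {σ : Matrix ι ι ℂ} (h : IsState σ) : IsState (crossMap K K σ) :=
  ⟨crossMap_posSemidef K h.1, by rw [trace_crossMap, hK, one_mul, h.2]⟩

theorem sum_conjTranspose_kraus_mul_kraus (A B : Matrix (ι × κ) (ι × κ) ℂ) (χ : κ → ℂ) (s t : ι) :
    (∑ i, (kraus A χ i)ᴴ * kraus B χ i) s t =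
      ∑ u, ∑ w, star (χ u) * (Aᴴ * B) (s, u) (t, w) * χ w := by
  simp only [Matrix.sum_apply, Matrix.mul_apply, kraus, Matrix.of_apply,
    Matrix.conjTranspose_apply, star_sum, star_mul', Finset.sum_mul, Finset.mul_sum,
    Fintype.sum_prod_type]
  rw [Finset.sum_comm]
  symm
  rw [Finset.sum_congr rfl fun x _ => Finset.sum_comm, Finset.sum_comm]
  refine Finset.sum_congr rfl fun y _ => ?_
  rw [Finset.sum_congr rfl fun x _ => Finset.sum_comm, Finset.sum_comm]
  refine Finset.sum_congr rfl fun x _ => ?_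
  rw [Finset.sum_comm]
  exact Finset.sum_congr rfl fun _ _ => Finset.sum_congr rfl fun _ _ => by ring

theorem sum_kraus_isometry [DecidableEq ι] [DecidableEq κ] {U : Matrix (ι × κ) (ι × κ) ℂ}
    (hU : U ∈ Matrix.unitaryGroup (ι × κ) ℂ) {χ : κ → ℂ} (hχ : IsUnitVec χ) :
    ∑ i, (kraus U χ i)ᴴ * kraus U χ i = 1 := by
  have h : Uᴴ * U = 1 := Matrix.mem_unitaryGroup_iff'.1 hU
  ext s t
  rw [sum_conjTranspose_kraus_mul_kraus, h]
  simp only [Matrix.one_apply, Prod.mk.injEq]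
  by_cases hst : s = t
  · simpa [hst, dotProduct, IsUnitVec] using hχ
  · simp [hst]

variable {α : Type}

/-- Reduced operator `Tr_out |x⟩⟨y|`. -/
def gram [Fintype α] (x y : ι × α → ℂ) : Matrix ι ι ℂ :=
  Matrix.of fun s t => ∑ f, x (s, f) * star (y (t, f))

theorem gram_add_left [Fintype α] (x x' y : ι × α → ℂ) :
    gram (x + x') y = gram x y + gram x' y := by
  ext; simp [gram, add_mul, Finset.sum_add_distrib]

theorem gram_add_right [Fintype α] (x y y' : ι × α → ℂ) :
    gram x (y + y') = gram x y + gram x y' := by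
  ext; simp [gram, mul_add, Finset.sum_add_distrib]

theorem gram_conjTranspose [Fintype α] (x y : ι × α → ℂ) : (gram x y)ᴴ = gram y x := by
  ext; simp [gram, mul_comm]

theorem gram_self_posSemidef [Fintype α] (x : ι × α → ℂ) : (gram x x).PosSemidef := by
  have : gram x x = (Matrix.of fun s f => x (s, f)) * (Matrix.of fun s f => x (s, f))ᴴ := by
    ext; simp [gram, Matrix.mul_apply]
  rw [this]
  exact Matrix.posSemidef_self_mul_conjTranspose _

theorem trace_gram [Fintype α] (x y : ι × α → ℂ) : (gram x y).trace = star y ⬝ᵥ x := by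
  simp [gram, Matrix.trace, dotProduct, Fintype.sum_prod_type, mul_comm]

/-- Time step with a fresh noise unit: `(step K x) (s, f) = ∑ t, K_{f n} s t * x (t, init f)`. -/
noncomputable def step (K : κ → Matrix ι ι ℂ) {n : ℕ} (x : ι × (Fin n → κ) → ℂ) :
    ι × (Fin (n + 1) → κ) → ℂ :=
  fun z => ∑ t, K (z.2 (Fin.last n)) z.1 t * x (t, Fin.init z.2)

theorem totalState_succ (W : Matrix (ι × κ) (ι × κ) ℂ) (φ : ι → ℂ) (χ : κ → ℂ) (n : ℕ) :
    totalState W φ χ (n + 1) = step (kraus W χ) (totalState W φ χ n) := by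
  funext x
  simp only [totalState, step, kraus, Matrix.of_apply, Finset.sum_mul]
  exact Finset.sum_congr rfl fun t _ => Finset.sum_congr rfl fun w _ => by ring

theorem sum_fin_succ_fun {M : Type*} [AddCommMonoid M] (n : ℕ) (F : (Fin (n + 1) → κ) → M) :
    ∑ f, F f = ∑ g : Fin n → κ, ∑ w, F (Fin.snoc g w) := by
  rw [← Fintype.sum_prod_type', ← (Fin.snocEquiv fun _ : Fin (n + 1) => κ).sum_comp,
    ← (Equiv.prodComm _ _).sum_comp]
  rfl

/-- The fresh unit is traced out along with the output, so reduced operators follow a closed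
recursion, even for two vectors driven by different Kraus families. All growth estimates rest on
this. -/
theorem gram_step (K L : κ → Matrix ι ι ℂ) {n : ℕ} (x y : ι × (Fin n → κ) → ℂ) :
    gram (step K x) (step L y) = crossMap K L (gram x y) := by
  ext s t
  simp only [gram, Matrix.of_apply, step, sum_fin_succ_fun, Fin.snoc_last, Fin.init_snoc,
    crossMap_apply, Matrix.sum_apply, Matrix.mul_apply, Matrix.conjTranspose_apply, star_sum,
    star_mul', Finset.sum_mul, Finset.mul_sum]
  rw [Finset.sum_comm]
  refine Finset.sum_congr rfl fun w _ => ?_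
  rw [Finset.sum_comm]
  refine Finset.sum_congr rfl fun t' _ => ?_
  rw [Finset.sum_comm]
  exact Finset.sum_congr rfl fun _ _ => Finset.sum_congr rfl fun _ _ => by ring

theorem step_add (K : κ → Matrix ι ι ℂ) {n : ℕ} (x y : ι × (Fin n → κ) → ℂ) :
    step K (x + y) = step K x + step K y := by
  funext z; simp [step, mul_add, Finset.sum_add_distrib]

end Kraus

/-! ### The component orthogonal to the stationary vector stays bounded -/

section Norm

variable {β : Type} [Fintype β]

/-- Euclidean norm of a vector. -/
noncomputable def nrm (x : β → ℂ) : ℝ := ‖(WithLp.toLp 2 x : EuclideanSpace ℂ β)‖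

theorem nrm_nonneg (x : β → ℂ) : 0 ≤ nrm x := norm_nonneg _

theorem nrm_sq (x : β → ℂ) : nrm x ^ 2 = ∑ b, ‖x b‖ ^ 2 := EuclideanSpace.norm_sq_eq _

theorem nrm_add_le (x y : β → ℂ) : nrm (x + y) ≤ nrm x + nrm y := norm_add_le _ _

theorem star_dotProduct_self (x : β → ℂ) : star x ⬝ᵥ x = ((nrm x ^ 2 : ℝ) : ℂ) := by
  rw [nrm_sq, star_dotProduct_self_eq]

theorem norm_star_dotProduct_le (x y : β → ℂ) : ‖star x ⬝ᵥ y‖ ≤ nrm x * nrm y := by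
  have := norm_inner_le_norm (𝕜 := ℂ) (WithLp.toLp 2 x : EuclideanSpace ℂ β) (WithLp.toLp 2 y)
  rwa [EuclideanSpace.inner_eq_star_dotProduct, dotProduct_comm] at this

end Norm

section Perp

variable {ι κ α : Type} [Fintype ι] [Fintype κ] [Fintype α]

theorem trace_gram_self (x : ι × α → ℂ) : (gram x x).trace = ((nrm x ^ 2 : ℝ) : ℂ) := by
  rw [trace_gram, star_dotProduct_self]

/-- `(⟨ψ| ⊗ 1) x`. -/
def coef (ψ : ι → ℂ) (x : ι × α → ℂ) : α → ℂ := fun f => ∑ t, star (ψ t) * x (t, f)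

/-- `((1 - |ψ⟩⟨ψ|) ⊗ 1) x`. -/
def perp (ψ : ι → ℂ) (x : ι × α → ℂ) : ι × α → ℂ := x - tens ψ (coef ψ x)

theorem coef_add (ψ : ι → ℂ) (x y : ι × α → ℂ) : coef ψ (x + y) = coef ψ x + coef ψ y := by
  funext f; simp [coef, mul_add, Finset.sum_add_distrib]

theorem coef_tens {ψ : ι → ℂ} (hψ : IsUnitVec ψ) (ξ : α → ℂ) : coef ψ (tens ψ ξ) = ξ := by
  have h : ∑ t, star (ψ t) * ψ t = 1 := hψ
  funext f
  simp only [coef, tens, ← mul_assoc]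
  rw [← Finset.sum_mul, h, one_mul]

theorem perp_add (ψ : ι → ℂ) (x y : ι × α → ℂ) : perp ψ (x + y) = perp ψ x + perp ψ y := by
  funext z; simp [perp, coef_add, tens, mul_add]; ring

theorem perp_tens {ψ : ι → ℂ} (hψ : IsUnitVec ψ) (ξ : α → ℂ) : perp ψ (tens ψ ξ) = 0 := by
  rw [perp, coef_tens hψ, sub_self]

theorem eq_tens_add_perp (ψ : ι → ℂ) (x : ι × α → ℂ) : x = tens ψ (coef ψ x) + perp ψ x := by
  simp [perp]

theorem trace_proj_mul_gram (ψ : ι → ℂ) (x : ι × α → ℂ) :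
    (proj ψ * gram x x).trace = ((nrm (coef ψ x) ^ 2 : ℝ) : ℂ) := by
  rw [← star_dotProduct_self]
  simp only [Matrix.trace, Matrix.diag_apply, Matrix.mul_apply, proj, Matrix.vecMulVec_apply, gram,
    Matrix.of_apply, dotProduct, coef, Pi.star_apply, star_sum, star_mul', star_star,
    Finset.sum_mul, Finset.mul_sum]
  rw [Finset.sum_congr rfl fun x _ => Finset.sum_comm, Finset.sum_comm]
  refine Finset.sum_congr rfl fun f _ => ?_
  rw [Finset.sum_comm]
  exact Finset.sum_congr rfl fun _ _ => Finset.sum_congr rfl fun _ _ => by ring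

theorem nrm_perp_sq {ψ : ι → ℂ} (hψ : IsUnitVec ψ) (x : ι × α → ℂ) :
    nrm (perp ψ x) ^ 2 = nrm x ^ 2 - nrm (coef ψ x) ^ 2 := by
  have h1 : star (tens ψ (coef ψ x)) ⬝ᵥ x = ((nrm (coef ψ x) ^ 2 : ℝ) : ℂ) := by
    rw [← star_dotProduct_self]
    simp only [dotProduct, Fintype.sum_prod_type, tens, Pi.star_apply, star_mul']
    rw [Finset.sum_comm]
    refine Finset.sum_congr rfl fun f _ => ?_
    conv_rhs => rw [coef, Finset.mul_sum]
    exact Finset.sum_congr rfl fun s _ => by simp only [coef]; ring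
  have h2 : star (tens ψ (coef ψ x)) ⬝ᵥ tens ψ (coef ψ x) =
      ((nrm (coef ψ x) ^ 2 : ℝ) : ℂ) := by
    have h : ∑ t, star (ψ t) * ψ t = 1 := hψ
    rw [← star_dotProduct_self]
    simp only [dotProduct, Fintype.sum_prod_type, tens, Pi.star_apply, star_mul']
    rw [Finset.sum_comm]
    refine Finset.sum_congr rfl fun f _ => ?_
    rw [← one_mul (star (coef ψ x f) * coef ψ x f), ← h, Finset.sum_mul]
    exact Finset.sum_congr rfl fun s _ => by ring
  have h3 : star x ⬝ᵥ tens ψ (coef ψ x) = ((nrm (coef ψ x) ^ 2 : ℝ) : ℂ) := by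
    have := congrArg star h1
    rw [Matrix.star_dotProduct, star_star, dotProduct_comm] at this
    rw [dotProduct_comm, this]
    simp
  have h4 : star (perp ψ x) ⬝ᵥ perp ψ x = ((nrm x ^ 2 - nrm (coef ψ x) ^ 2 : ℝ) : ℂ) := by
    rw [perp, star_sub, sub_dotProduct, dotProduct_sub, dotProduct_sub, h1, h2, h3,
      star_dotProduct_self]
    push_cast
    ring
  rw [star_dotProduct_self] at h4
  exact_mod_cast h4

theorem nrm_perp_le {ψ : ι → ℂ} (hψ : IsUnitVec ψ) (x : ι × α → ℂ) :
    nrm (perp ψ x) ≤ nrm x := by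
  have := nrm_perp_sq hψ x
  exact (sq_le_sq₀ (nrm_nonneg _) (nrm_nonneg _)).1 (by linarith [sq_nonneg (nrm (coef ψ x))])

theorem nrm_perp_sq_eq_trace [DecidableEq ι] {ψ : ι → ℂ} (hψ : IsUnitVec ψ) (x : ι × α → ℂ) :
    nrm (perp ψ x) ^ 2 = ((1 - proj ψ) * gram x x).trace.re := by
  rw [sub_mul, one_mul, Matrix.trace_sub, trace_gram_self, trace_proj_mul_gram, nrm_perp_sq hψ,
    Complex.sub_re, Complex.ofReal_re, Complex.ofReal_re]

/-- Cauchy–Schwarz for each output index f separately. It dominates every reduced operator by a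
multiple of the identity, which makes the contraction below uniform in the vector and in n. -/
theorem trace_smul_one_sub_gram_posSemidef [DecidableEq ι] (x : ι × α → ℂ) :
    (((nrm x ^ 2 : ℝ) : ℂ) • (1 : Matrix ι ι ℂ) - gram x x).PosSemidef := by
  refine Matrix.PosSemidef.of_dotProduct_mulVec_nonneg ?_ fun w => ?_
  · rw [Matrix.IsHermitian, Matrix.conjTranspose_sub, gram_conjTranspose,
      Matrix.conjTranspose_smul]
    simp
  · have h1 : star w ⬝ᵥ (gram x x *ᵥ w) = ((nrm (coef w x) ^ 2 : ℝ) : ℂ) := by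
      rw [← trace_proj_mul_gram, proj, Matrix.vecMulVec_mul, Matrix.trace_vecMulVec,
        Matrix.dotProduct_mulVec, dotProduct_comm]
    have h2 : nrm (coef w x) ^ 2 ≤ nrm x ^ 2 * nrm w ^ 2 := by
      rw [nrm_sq, nrm_sq x, Fintype.sum_prod_type, Finset.sum_comm, Finset.sum_mul]
      refine Finset.sum_le_sum fun f _ => ?_
      have := norm_star_dotProduct_le w (fun t => x (t, f))
      have h3 : ‖coef w x f‖ ≤ nrm w * nrm (fun t => x (t, f)) := this
      rw [← nrm_sq (fun t => x (t, f)), mul_comm, ← mul_pow]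
      exact pow_le_pow_left₀ (norm_nonneg _) h3 2
    rw [Matrix.sub_mulVec, dotProduct_sub, h1, Matrix.smul_mulVec, Matrix.one_mulVec,
      dotProduct_smul, star_dotProduct_self, smul_eq_mul, ← Complex.ofReal_mul,
      ← Complex.ofReal_sub, Complex.zero_le_real]
    linarith

/-! #### Iterated time steps -/

/-- `m` time steps. -/
noncomputable def stepIter (K : κ → Matrix ι ι ℂ) {n : ℕ} (x : ι × (Fin n → κ) → ℂ) :
    (m : ℕ) → ι × (Fin (n + m) → κ) → ℂ
  | 0 => x
  | m + 1 => step K (stepIter K x m)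

theorem gram_stepIter (K : κ → Matrix ι ι ℂ) {n : ℕ} (x : ι × (Fin n → κ) → ℂ) (m : ℕ) :
    gram (stepIter K x m) (stepIter K x m) = ((crossMap K K) ^ m) (gram x x) := by
  induction m with
  | zero => rfl
  | succ m ih => rw [stepIter, gram_step, ih, pow_succ']; rfl

variable {K : κ → Matrix ι ι ℂ} {ψ : ι → ℂ} {χ : κ → ℂ}

theorem nrm_step [DecidableEq ι] (hK : ∑ i, (K i)ᴴ * K i = 1) {n : ℕ}
    (x : ι × (Fin n → κ) → ℂ) : nrm (step K x) = nrm x := by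
  have h : (gram (step K x) (step K x)).trace = (gram x x).trace := by
    rw [gram_step, trace_crossMap, hK, one_mul]
  rw [trace_gram_self, trace_gram_self] at h
  have h' : nrm (step K x) ^ 2 = nrm x ^ 2 := by exact_mod_cast h
  exact (pow_left_inj₀ (nrm_nonneg _) (nrm_nonneg _) two_ne_zero).1 h'

theorem step_tens (hKψ : ∀ i, K i *ᵥ ψ = χ i • ψ) {n : ℕ} (ξ : (Fin n → κ) → ℂ) :
    step K (tens ψ ξ) = tens ψ fun f => ξ (Fin.init f) * χ (f (Fin.last n)) := by
  funext z
  have h := congrFun (hKψ (z.2 (Fin.last n))) z.1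
  simp only [Matrix.mulVec, dotProduct, Pi.smul_apply, smul_eq_mul] at h
  simp only [step, tens, ← mul_assoc]
  rw [← Finset.sum_mul, h]
  ring

/-- The component along ψ stays along ψ and feeds nothing into the orthogonal one. -/
theorem perp_step (hψ : IsUnitVec ψ) (hKψ : ∀ i, K i *ᵥ ψ = χ i • ψ) {n : ℕ}
    (x : ι × (Fin n → κ) → ℂ) : perp ψ (step K x) = perp ψ (step K (perp ψ x)) := by
  conv_lhs => rw [eq_tens_add_perp ψ x, step_add, perp_add, step_tens hKψ, perp_tens hψ, zero_add]

theorem nrm_perp_step_le [DecidableEq ι] (hK : ∑ i, (K i)ᴴ * K i = 1) (hψ : IsUnitVec ψ)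
    (hKψ : ∀ i, K i *ᵥ ψ = χ i • ψ) {n : ℕ} (x : ι × (Fin n → κ) → ℂ) :
    nrm (perp ψ (step K x)) ≤ nrm (perp ψ x) := by
  rw [perp_step hψ hKψ]
  exact (nrm_perp_le hψ _).trans (nrm_step hK _).le

theorem perp_stepIter (hψ : IsUnitVec ψ) (hKψ : ∀ i, K i *ᵥ ψ = χ i • ψ) {n : ℕ}
    (x : ι × (Fin n → κ) → ℂ) (m : ℕ) :
    perp ψ (stepIter K x m) = perp ψ (stepIter K (perp ψ x) m) := by
  induction m with
  | zero =>
    conv_lhs => rw [stepIter, eq_tens_add_perp ψ x, perp_add, perp_tens hψ, zero_add]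
    rfl
  | succ m ih => rw [stepIter, stepIter, perp_step hψ hKψ, ih, ← perp_step hψ hKψ]

/-- The previous domination by the identity, for a one-point output space and ψ as joint vector. -/
theorem posSemidef_one_sub_proj [DecidableEq ι] (hψ : IsUnitVec ψ) :
    (1 - proj ψ).PosSemidef := by
  have h := trace_smul_one_sub_gram_posSemidef (fun z : ι × Unit => ψ z.1)
  have h1 : nrm (fun z : ι × Unit => ψ z.1) ^ 2 = 1 := by
    have h2 : ((nrm ψ ^ 2 : ℝ) : ℂ) = 1 := by rw [← star_dotProduct_self]; exact hψ
    rw [nrm_sq, Fintype.sum_prod_type]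
    rw [nrm_sq] at h2
    simpa using (by exact_mod_cast h2 : ∑ b, ‖ψ b‖ ^ 2 = 1)
  have h3 : gram (fun z : ι × Unit => ψ z.1) (fun z : ι × Unit => ψ z.1) = proj ψ := by
    ext; simp [gram, proj, Matrix.vecMulVec_apply]
  rw [h1, h3] at h
  simpa using h

open scoped MatrixOrder in
theorem trace_mul_nonneg {A B : Matrix ι ι ℂ} (hA : A.PosSemidef) (hB : B.PosSemidef) :
    0 ≤ (A * B).trace.re := by
  classical
  obtain ⟨C, rfl⟩ := CStarAlgebra.nonneg_iff_eq_star_mul_self.mp hA.nonneg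
  rw [Matrix.star_eq_conjTranspose, Matrix.mul_assoc, Matrix.trace_mul_comm]
  exact (Complex.le_def.1 (hB.mul_mul_conjTranspose_same C).trace_nonneg).1

theorem pow_crossMap_posSemidef (K : κ → Matrix ι ι ℂ) {X : Matrix ι ι ℂ} (hX : X.PosSemidef)
    (m : ℕ) : ((crossMap K K ^ m) X).PosSemidef := by
  induction m with
  | zero => simpa using hX
  | succ m ih => rw [pow_succ']; exact crossMap_posSemidef K ih

/-- The Cesàro means of the orbit of 1 tend to a multiple of |ψ⟩⟨ψ|, so the averages of these traces
tend to 0 and cannot all exceed 1/4. The value 1/4 is chosen because it halves a norm after taking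
square roots. -/
theorem exists_trace_pow_one_le [DecidableEq ι] (hK : ∑ i, (K i)ᴴ * K i = 1) (hψ : IsUnitVec ψ)
    (hu : IsUniqueStationaryState (crossMap K K) (proj ψ)) :
    ∃ m, ((1 - proj ψ) * (crossMap K K ^ m) 1).trace.re ≤ 1 / 4 := by
  by_contra! hm
  have h1 := tendsto_cesaro (fun σ h => h.crossMap hK) hu 1
  have hc : Continuous fun X : Matrix ι ι ℂ => ((1 - proj ψ) * X).trace.re := by fun_prop
  have h2 := (hc.tendsto _).comp h1
  have hpp : proj ψ * proj ψ = proj ψ := by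
    rw [proj, Matrix.vecMulVec_mul_vecMulVec, show star ψ ⬝ᵥ ψ = 1 from hψ, one_smul]
  have h3 : ((1 - proj ψ) * ((1 : Matrix ι ι ℂ).trace • proj ψ)).trace.re = 0 := by
    rw [Matrix.mul_smul, sub_mul, one_mul, hpp, sub_self]
    simp
  rw [h3] at h2
  refine absurd (ge_of_tendsto' h2 (b := 1 / 4) fun n => ?_) (by norm_num)
  have h4 : ((1 - proj ψ) * cesaro (crossMap K K) 1 n).trace =
      (((n : ℝ) + 1)⁻¹ : ℝ) * ∑ m ∈ Finset.range (n + 1),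
        ((1 - proj ψ) * (crossMap K K ^ m) 1).trace := by
    rw [cesaro, Matrix.mul_smul, Matrix.trace_smul, Finset.mul_sum, Matrix.trace_sum]
    simp
  simp only [Function.comp]
  rw [h4, Complex.re_ofReal_mul, Complex.re_sum, ← div_eq_inv_mul, le_div_iff₀ (by positivity)]
  refine le_trans (le_of_eq ?_) (Finset.sum_le_sum fun m _ => (hm m).le)
  simp
  ring

theorem exists_nrm_perp_stepIter_le [DecidableEq ι] (hK : ∑ i, (K i)ᴴ * K i = 1)
    (hψ : IsUnitVec ψ) (hKψ : ∀ i, K i *ᵥ ψ = χ i • ψ)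
    (hu : IsUniqueStationaryState (crossMap K K) (proj ψ)) :
    ∃ m, ∀ (n : ℕ) (x : ι × (Fin n → κ) → ℂ),
      nrm (perp ψ (stepIter K x m)) ≤ nrm (perp ψ x) / 2 := by
  obtain ⟨m, hm⟩ := exists_trace_pow_one_le hK hψ hu
  refine ⟨m, fun n x => ?_⟩
  rw [perp_stepIter hψ hKψ]
  set y := perp ψ x
  -- T^m is positive, so gram y y ≤ ‖y‖² · 1 persists after m steps and can be paired with 1 −
  -- |ψ⟩⟨ψ|.
  have h1 := trace_mul_nonneg (posSemidef_one_sub_proj hψ)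
    (pow_crossMap_posSemidef K (trace_smul_one_sub_gram_posSemidef y) m)
  rw [map_sub, map_smul, mul_sub, Matrix.trace_sub, Matrix.mul_smul, Matrix.trace_smul,
    smul_eq_mul, Complex.sub_re, Complex.re_ofReal_mul, ← gram_stepIter,
    ← nrm_perp_sq_eq_trace hψ] at h1
  have h2 := mul_le_mul_of_nonneg_left hm (sq_nonneg (nrm y))
  refine (sq_le_sq₀ (nrm_nonneg _) (by linarith [nrm_nonneg y])).1 ?_
  rw [div_pow]
  linarith

theorem bounded_of_contraction {a : ℕ → ℝ} {c : ℝ} {m : ℕ} (hc : 0 ≤ c) (h0 : ∀ n, 0 ≤ a n)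
    (h1 : ∀ n, a (n + 1) ≤ a n + c) (h2 : ∀ n, a (n + m) ≤ a n / 2 + m * c) :
    ∃ C, ∀ n, a n ≤ C := by
  have hmc : 0 ≤ m * c := by positivity
  -- The number 2mc is the fixed point of t ↦ t/2 + mc; the term a 0 covers the start of the
  -- sequence.
  refine ⟨a 0 + 2 * (m * c), fun n => ?_⟩
  -- For m = 0 the contraction reads a n ≤ a n / 2 and forces a n ≤ 0.
  rcases Nat.eq_zero_or_pos m with rfl | hm
  · have := h2 n
    have := h0 0
    simp at *
    linarith
  induction n using Nat.strong_induction_on with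
  | _ n ih =>
    by_cases hn : n < m
    · have h3 : ∀ j, a j ≤ a 0 + j * c := fun j => by
        induction j with
        | zero => simp
        | succ j ihj => push_cast; linarith [h1 j]
      have : (n : ℝ) * c ≤ m * c :=
        mul_le_mul_of_nonneg_right (by exact_mod_cast hn.le) hc
      linarith [h3 n]
    · obtain ⟨j, rfl⟩ := Nat.exists_eq_add_of_le' (not_lt.1 hn)
      linarith [h2 j, ih j (by omega), h0 0]

/-- Over m steps the drive contributes at most m c to the orthogonal part, since single steps do not
increase it, while the part inherited from y n is halved. -/
theorem exists_nrm_perp_le [DecidableEq ι] (hK : ∑ i, (K i)ᴴ * K i = 1)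
    (hψ : IsUnitVec ψ) (hKψ : ∀ i, K i *ᵥ ψ = χ i • ψ)
    (hu : IsUniqueStationaryState (crossMap K K) (proj ψ))
    (y b : (n : ℕ) → ι × (Fin n → κ) → ℂ) (hy : ∀ n, y (n + 1) = b (n + 1) + step K (y n))
    {c : ℝ} (hb : ∀ n, nrm (b (n + 1)) ≤ c) : ∃ C, ∀ n, nrm (perp ψ (y n)) ≤ C := by
  obtain ⟨m, hm⟩ := exists_nrm_perp_stepIter_le hK hψ hKψ hu
  have hc : 0 ≤ c := (nrm_nonneg _).trans (hb 0)
  refine bounded_of_contraction (c := c) (m := m) hc (fun n => nrm_nonneg _) (fun n => ?_)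
    fun n => ?_
  · rw [hy, perp_add]
    linarith [nrm_add_le (perp ψ (b (n + 1))) (perp ψ (step K (y n))),
      (nrm_perp_le hψ (b (n + 1))).trans (hb n), nrm_perp_step_le hK hψ hKψ (y n)]
  · have key : ∀ j, ∃ e : ι × (Fin (n + j) → κ) → ℂ,
        y (n + j) = e + stepIter K (y n) j ∧ nrm (perp ψ e) ≤ j * c := fun j => by
      induction j with
      | zero =>
        refine ⟨0, by simp [stepIter], ?_⟩
        have : perp ψ (0 : ι × (Fin (n + 0) → κ) → ℂ) = 0 := by
          funext z; simp [perp, coef, tens]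
        rw [this]
        simp [nrm]
      | succ j ih =>
        obtain ⟨e, he, hle⟩ := ih
        refine ⟨b (n + j + 1) + step K e, ?_, ?_⟩
        · have h := hy (n + j)
          rw [he, step_add, ← add_assoc] at h
          exact h
        · rw [perp_add]
          push_cast
          linarith [nrm_add_le (perp ψ (b (n + j + 1))) (perp ψ (step K e)),
            (nrm_perp_le hψ (b (n + j + 1))).trans (hb (n + j)), nrm_perp_step_le hK hψ hKψ e]
    obtain ⟨e, he, hle⟩ := key m
    rw [he, perp_add]
    linarith [nrm_add_le (perp ψ e) (perp ψ (stepIter K (y n) m)), hm n (y n)]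

end Perp

/-! ### The Moore-Penrose inverse and the linear growth of the cross terms -/

section Rate

variable {ι κ : Type} [Fintype ι] [Fintype κ] [DecidableEq ι]

theorem trace_dualTransition_mul (U : Matrix (ι × κ) (ι × κ) ℂ) (χ : κ → ℂ) (X Y : Matrix ι ι ℂ) :
    (dualTransition U χ X * Y).trace = (X * transition U χ Y).trace := by
  rw [transition_eq_crossMap, crossMap_apply]
  change ((∑ i, (kraus U χ i)ᴴ * X * kraus U χ i) * Y).trace = _
  rw [Finset.sum_mul, Finset.mul_sum, Matrix.trace_sum, Matrix.trace_sum]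
  refine Finset.sum_congr rfl fun i _ => ?_
  rw [Matrix.mul_assoc, Matrix.mul_assoc, Matrix.trace_mul_comm, Matrix.mul_assoc]

theorem dualTransition_conjTranspose (U : Matrix (ι × κ) (ι × κ) ℂ) (χ : κ → ℂ)
    (X : Matrix ι ι ℂ) : (dualTransition U χ X)ᴴ = dualTransition U χ Xᴴ := by
  change (∑ i, (kraus U χ i)ᴴ * X * kraus U χ i)ᴴ = ∑ i, (kraus U χ i)ᴴ * Xᴴ * kraus U χ i
  simp [Matrix.conjTranspose_sum, Matrix.mul_assoc]

theorem trace_one_sub_dualTransition_mul (U : Matrix (ι × κ) (ι × κ) ℂ) (χ : κ → ℂ)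
    (X Y : Matrix ι ι ℂ) :
    ((1 - dualTransition U χ) X * Y).trace = (X * (Y - transition U χ Y)).trace := by
  rw [LinearMap.sub_apply, Module.End.one_apply, sub_mul, mul_sub, Matrix.trace_sub,
    Matrix.trace_sub, trace_dualTransition_mul]

variable {U : Matrix (ι × κ) (ι × κ) ℂ} {χ : κ → ℂ} {ρ : Matrix ι ι ℂ}
  {R : Module.End ℂ (Matrix ι ι ℂ)}

theorem IsState.transition (hK : ∑ i, (kraus U χ i)ᴴ * kraus U χ i = 1) {σ : Matrix ι ι ℂ}
    (h : IsState σ) : IsState (transition U χ σ) := by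
  rw [transition_eq_crossMap]; exact h.crossMap hK

/-- Operators with vanishing stationary mean lie in the range of `Id - T*`. -/
theorem IsMoorePenrose.apply_of_trace_eq_zero
    (hR : IsMoorePenrose (1 - dualTransition U χ) R)
    (hK : ∑ i, (kraus U χ i)ᴴ * kraus U χ i = 1)
    (hρ : IsUniqueStationaryState (transition U χ) ρ) {X : Matrix ι ι ℂ}
    (hX : (ρ * X).trace = 0) : (1 - dualTransition U χ) (R X) = X := by
  obtain ⟨h1, -, h3, -⟩ := hR
  set S := 1 - dualTransition U χ with hS
  set Z := X - (S * R) X with hZ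
  have hPZ : (S * R) Z = 0 := by
    rw [hZ, map_sub, ← Module.End.mul_apply, ← mul_assoc, h1, sub_self]
  have hT : transition U χ Zᴴ = Zᴴ := by
    symm
    rw [← sub_eq_zero]
    refine Matrix.ext_iff_trace_mul_left.2 fun W => ?_
    have h4 := h3 Z (S W)
    rw [← Module.End.mul_apply, h1, hPZ, Matrix.conjTranspose_zero, zero_mul, Matrix.trace_zero,
      Matrix.trace_mul_comm, hS, trace_one_sub_dualTransition_mul] at h4
    rw [← h4, mul_zero, Matrix.trace_zero]
  have hc := eq_trace_smul_of_fixed (fun σ h => h.transition hK) hρ hT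
  have h5 : (Zᴴ * Z).trace = 0 := by
    have h6 := h3 Z X
    rw [hPZ, Matrix.conjTranspose_zero, zero_mul, Matrix.trace_zero] at h6
    conv_lhs => rw [hZ, ← hZ, mul_sub, Matrix.trace_sub, ← h6, sub_zero, hc]
    rw [Matrix.smul_mul, Matrix.trace_smul, hX, smul_zero]
  have h7 : Z = 0 := Matrix.trace_conjTranspose_mul_self_eq_zero_iff.1 h5
  exact (sub_eq_zero.1 h7).symm

theorem trace_transition (hK : ∑ i, (kraus U χ i)ᴴ * kraus U χ i = 1) (X : Matrix ι ι ℂ) :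
    (transition U χ X).trace = X.trace := by
  rw [transition_eq_crossMap, trace_crossMap, hK, one_mul]

theorem trace_pow_transition (hK : ∑ i, (kraus U χ i)ᴴ * kraus U χ i = 1) (X : Matrix ι ι ℂ)
    (n : ℕ) : ((transition U χ ^ n) X).trace = X.trace := by
  induction n with
  | zero => rfl
  | succ n ih => rw [pow_succ', Module.End.mul_apply, trace_transition hK, ih]

/-- T is power bounded; this controls the boundary terms left by telescoping. -/
theorem exists_norm_trace_mul_pow_le (hK : ∑ i, (kraus U χ i)ᴴ * kraus U χ i = 1)
    (A X : Matrix ι ι ℂ) :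
    ∃ C : ℝ, ∀ n, ‖(A * (X - (transition U χ ^ n) X)).trace‖ ≤ C := by
  obtain ⟨C, hC⟩ := exists_norm_pow_apply_le (fun σ h => h.transition (χ := χ) (U := U) hK) X
  refine ⟨∑ s, ∑ t, ‖A s t‖ * (2 * C), fun n => ?_⟩
  simp only [Matrix.trace, Matrix.diag_apply, Matrix.mul_apply]
  refine (norm_sum_le _ _).trans (Finset.sum_le_sum fun s _ => (norm_sum_le _ _).trans
    (Finset.sum_le_sum fun t _ => ?_))
  rw [norm_mul]
  refine mul_le_mul_of_nonneg_left ?_ (norm_nonneg _)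
  have h0 : ‖X t s‖ ≤ C := by simpa using hC 0 t s
  rw [Matrix.sub_apply]
  exact (norm_sub_le _ _).trans (by linarith [hC n t s])

/-- Z minus its stationary mean equals (Id − T*) A, so each summand becomes a difference of
consecutive powers. Subtracting the mean costs nothing because every T^m Y is traceless. -/
theorem sum_trace_mul_pow (hR : IsMoorePenrose (1 - dualTransition U χ) R)
    (hK : ∑ i, (kraus U χ i)ᴴ * kraus U χ i = 1)
    (hρ : IsUniqueStationaryState (transition U χ) ρ) {Y : Matrix ι ι ℂ} (hY : Y.trace = 0)
    (Z : Matrix ι ι ℂ) : ∃ A : Matrix ι ι ℂ, ∀ n,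
      ∑ m ∈ Finset.range n, (Z * (transition U χ ^ m) Y).trace =
        (A * (Y - (transition U χ ^ n) Y)).trace := by
  set z := (ρ * Z).trace
  have h0 : (ρ * (Z - z • 1)).trace = 0 := by
    rw [mul_sub, Matrix.trace_sub, Matrix.mul_smul, mul_one, Matrix.trace_smul, hρ.1.2]
    simp [z]
  have h1 := hR.apply_of_trace_eq_zero hK hρ h0
  refine ⟨R (Z - z • 1), fun n => ?_⟩
  have h2 : ∀ m, (Z * (transition U χ ^ m) Y).trace = (R (Z - z • 1) *
      ((transition U χ ^ m) Y - (transition U χ ^ (m + 1)) Y)).trace := fun m => by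
    rw [pow_succ', Module.End.mul_apply, ← trace_one_sub_dualTransition_mul, h1, sub_mul,
      Matrix.trace_sub, Matrix.smul_mul, one_mul, Matrix.trace_smul, trace_pow_transition hK, hY,
      smul_zero, sub_zero]
  rw [Finset.sum_congr rfl fun m _ => h2 m, ← Matrix.trace_sum, ← Finset.mul_sum,
    Finset.sum_range_sub' (fun m => (transition U χ ^ m) Y)]
  simp

theorem re_trace_mul_conjTranspose {G Z : Matrix ι ι ℂ} (hG : Gᴴ = G) :
    (G * Zᴴ).trace.re = (G * Z).trace.re := by
  have : (G * Zᴴ).trace = star (G * Z).trace := by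
    rw [← Matrix.trace_conjTranspose, Matrix.conjTranspose_mul, hG, Matrix.trace_mul_comm]
  rw [this]
  simp

theorem imPart_isHermitian (X : Matrix ι ι ℂ) : (imPart X)ᴴ = imPart X := by
  rw [imPart, Matrix.conjTranspose_smul, Matrix.conjTranspose_sub, Matrix.conjTranspose_conjTranspose,
    ← neg_sub, smul_neg, ← neg_smul]
  congr 1
  simp

/-- The cross terms grow linearly up to a bounded error. -/
theorem exists_sum_re_trace_sub_le (hR : IsMoorePenrose (1 - dualTransition U χ) R)
    (hK : ∑ i, (kraus U χ i)ᴴ * kraus U χ i = 1)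
    (hρ : IsUniqueStationaryState (transition U χ) ρ) (L : κ → Matrix ι ι ℂ)
    (hL : (∑ i, (L i)ᴴ * kraus U χ i)ᴴ = -∑ i, (L i)ᴴ * kraus U χ i)
    (hY : (crossMap L (kraus U χ) ρ).trace = 0) (η : ℕ → Matrix ι ι ℂ) (h0 : η 0 = 0)
    (hη : ∀ n, η (n + 1) = crossMap L (kraus U χ) ρ + transition U χ (η n)) :
    ∃ C : ℝ, ∀ n : ℕ, |∑ m ∈ Finset.range n, ((∑ i, (L i)ᴴ * kraus U χ i) * η m).trace.re -
      n * ∑ i, (imPart (kraus U χ i * ρ * (L i)ᴴ) *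
        R (imPart (∑ j, (L j)ᴴ * kraus U χ j))).trace.re| ≤ C := by
  set K := kraus U χ with hKdef
  set B := ∑ i, (L i)ᴴ * K i with hB
  set Y := crossMap L K ρ with hYdef
  set H := imPart B with hH
  have hρh : ρᴴ = ρ := hρ.1.1.isHermitian
  have hBH : B = Complex.I • H := by
    rw [hH, imPart, hL, smul_smul, sub_neg_eq_add, ← two_smul ℂ, smul_smul]
    have : Complex.I * (1 / (2 * Complex.I)) * 2 = 1 := by
      field_simp
    rw [this, one_smul]
  -- Tr(ρB) is the complex conjugate of Tr Y. With the zero mean, H falls in the range of Id − T*.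
  have hρB : (ρ * B).trace = 0 := by
    rw [Matrix.trace_mul_comm, hB, ← trace_crossMap, ← hρh, ← crossMap_conjTranspose,
      Matrix.trace_conjTranspose, ← hYdef, hY, star_zero]
  have hρH : (ρ * H).trace = 0 := by
    rw [hBH, Matrix.mul_smul, Matrix.trace_smul, smul_eq_mul] at hρB
    exact (mul_eq_zero.1 hρB).resolve_left Complex.I_ne_zero
  have hSZ := hR.apply_of_trace_eq_zero hK hρ hρH
  set Z := R H with hZ
  -- The Hermitian part of R H solves the same equation, as H is Hermitian and T* commutes with
  -- adjoints. Its pairing with Hermitian operators has the same real part, so the rate is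
  -- unaffected.
  set Zh : Matrix ι ι ℂ := (1 / 2 : ℂ) • (Z + Zᴴ) with hZh
  have hZhh : Zhᴴ = Zh := by
    rw [hZh, Matrix.conjTranspose_smul, Matrix.conjTranspose_add,
      Matrix.conjTranspose_conjTranspose, add_comm Zᴴ]
    simp
  have hSZh : (1 - dualTransition U χ) Zh = H := by
    have h1 : (1 - dualTransition U χ) Zᴴ = H := by
      have := congrArg Matrix.conjTranspose hSZ
      rw [LinearMap.sub_apply, Module.End.one_apply, Matrix.conjTranspose_sub,
        dualTransition_conjTranspose, hH, imPart_isHermitian] at this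
      exact this
    rw [hZh, map_smul, map_add, hSZ, h1, ← two_smul ℂ, smul_smul]
    norm_num
  have hη' : ∀ n, η n - transition U χ (η n) = Y - (transition U χ ^ n) Y := fun n => by
    induction n with
    | zero => simp [h0]
    | succ n ih =>
      rw [hη, map_add, add_sub_add_comm, ← map_sub, ih, map_sub, pow_succ',
        Module.End.mul_apply (transition U χ)]
      abel
  -- Moving Id − T* onto η_n leaves the constant Tr(Zh Y), which produces the rate, and a remainder
  -- whose partial sums are bounded by the preceding telescoping.
  have hHη : ∀ n, (H * η n).trace = (Zh * Y).trace - (Zh * (transition U χ ^ n) Y).trace :=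
    fun n => by
      rw [← hSZh, trace_one_sub_dualTransition_mul, hη', mul_sub, Matrix.trace_sub]
  obtain ⟨A, hA⟩ := sum_trace_mul_pow hR hK hρ hY Zh
  obtain ⟨C, hC⟩ := exists_norm_trace_mul_pow_le hK A Y
  have hrate : ∑ i, (imPart (K i * ρ * (L i)ᴴ) * Z).trace.re =
      (Complex.I * (Zh * Y).trace).re := by
    have h1 : ∑ i, (imPart (K i * ρ * (L i)ᴴ) * Z).trace.re = (imPart Yᴴ * Z).trace.re := by
      rw [← Complex.re_sum, ← Matrix.trace_sum, ← Finset.sum_mul]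
      congr 3
      simp only [imPart]
      rw [← Finset.smul_sum, Finset.sum_sub_distrib, hYdef, crossMap_conjTranspose, hρh,
        crossMap_apply, ← Matrix.conjTranspose_sum]
    have h2 : (imPart Yᴴ * Z).trace.re = (imPart Yᴴ * Zh).trace.re := by
      rw [hZh, Matrix.mul_smul, Matrix.trace_smul, mul_add, Matrix.trace_add]
      have := re_trace_mul_conjTranspose (Z := Z) (imPart_isHermitian Yᴴ)
      simp [this]
      ring
    have h3 : (Yᴴ * Zh).trace = star (Zh * Y).trace := by
      rw [← Matrix.trace_conjTranspose, Matrix.conjTranspose_mul, hZhh]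
    rw [h1, h2, imPart, Matrix.conjTranspose_conjTranspose, Matrix.smul_mul, Matrix.trace_smul,
      sub_mul, Matrix.trace_sub, h3, Matrix.trace_mul_comm Y Zh]
    generalize (Zh * Y).trace = w
    have : (1 / (2 * Complex.I)) = -Complex.I / 2 := by
      field_simp
      simp
    rw [this]
    simp
    ring
  refine ⟨C, fun n => ?_⟩
  have hsum : ∑ m ∈ Finset.range n, (B * η m).trace.re =
      n * (Complex.I * (Zh * Y).trace).re -
        (Complex.I * (A * (Y - (transition U χ ^ n) Y)).trace).re := by
    rw [← hA, ← Complex.re_sum]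
    have h1 : ∀ m, (B * η m).trace = Complex.I *
        ((Zh * Y).trace - (Zh * (transition U χ ^ m) Y).trace) := fun m => by
      rw [← hHη, hBH, Matrix.smul_mul, Matrix.trace_smul, smul_eq_mul]
    rw [Finset.sum_congr rfl fun m _ => h1 m, ← Finset.mul_sum, Finset.sum_sub_distrib,
      Finset.sum_const, Finset.card_range, mul_sub, Complex.sub_re]
    congr 1
    rw [nsmul_eq_mul, ← mul_assoc, mul_comm Complex.I, mul_assoc, ← Complex.ofReal_natCast,
      Complex.re_ofReal_mul]
  rw [hsum, hrate, sub_sub_cancel_left, abs_neg]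
  refine (Complex.abs_re_le_norm _).trans ?_
  rw [norm_mul, Complex.norm_I, one_mul]
  exact hC n

end Rate

/-! ### The derivative of the joint state and its quantum Fisher information -/

section Derivative

variable {ι κ : Type} [Fintype ι] [Fintype κ]

/-- The derivative of `totalState`, when `W` has derivative `W'`. -/
noncomputable def dotState (W W' : Matrix (ι × κ) (ι × κ) ℂ) (φ : ι → ℂ) (χ : κ → ℂ) :
    (n : ℕ) → ι × (Fin n → κ) → ℂ
  | 0 => 0
  | n + 1 => step (kraus W' χ) (totalState W φ χ n) + step (kraus W χ) (dotState W W' φ χ n)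

theorem hasDerivAt_totalState {W : ℝ → Matrix (ι × κ) (ι × κ) ℂ} {W' : Matrix (ι × κ) (ι × κ) ℂ}
    {θ₀ : ℝ} (hW : ∀ a b, HasDerivAt (fun θ => W θ a b) (W' a b) θ₀) (φ : ι → ℂ) (χ : κ → ℂ)
    (n : ℕ) (z : ι × (Fin n → κ)) :
    HasDerivAt (fun θ => totalState (W θ) φ χ n z) (dotState (W θ₀) W' φ χ n z) θ₀ := by
  induction n with
  | zero => exact hasDerivAt_const _ _
  | succ n ih =>
    have hK : ∀ i s t, HasDerivAt (fun θ => kraus (W θ) χ i s t) (kraus W' χ i s t) θ₀ :=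
      fun i s t => HasDerivAt.fun_sum fun u _ => (hW _ _).mul_const _
    simp only [totalState_succ]
    have := HasDerivAt.fun_sum (u := Finset.univ) fun t (_ : t ∈ Finset.univ) =>
      (hK (z.2 (Fin.last n)) z.1 t).mul (ih (t, Fin.init z.2))
    refine this.congr_deriv ?_
    simp [dotState, step, Finset.sum_add_distrib]

/-- For a pure state, twice the derivative of the projection is a logarithmic derivative. The
orthogonality of Φ and Ψ removes the extra terms of Lρ + ρL. -/
theorem isSLD_proj {β : Type} [Fintype β] {Ψ : ℝ → β → ℂ} {Φ : β → ℂ} {θ₀ : ℝ}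
    (hΨ : ∀ b, HasDerivAt (fun θ => Ψ θ b) (Φ b) θ₀) (h1 : star (Ψ θ₀) ⬝ᵥ Ψ θ₀ = 1)
    (h0 : star (Ψ θ₀) ⬝ᵥ Φ = 0) (h0' : star Φ ⬝ᵥ Ψ θ₀ = 0) :
    IsSLD (fun θ => proj (Ψ θ)) θ₀ ((2 : ℂ) • (Matrix.vecMulVec Φ (star (Ψ θ₀)) +
      Matrix.vecMulVec (Ψ θ₀) (star Φ))) := by
  constructor
  · simp [Matrix.IsHermitian, Matrix.conjTranspose_smul, Matrix.conjTranspose_add,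
      Matrix.conjTranspose_vecMulVec, add_comm]
  · intro a b
    have h := (hΨ a).mul ((hΨ b).star)
    refine h.congr_deriv ?_
    simp only [proj, Matrix.smul_mul, Matrix.mul_smul, Matrix.add_mul, Matrix.mul_add,
      Matrix.vecMulVec_mul_vecMulVec, h1, h0, h0', Matrix.add_apply, Matrix.smul_apply,
      Matrix.vecMulVec_apply, Pi.star_apply, Pi.smul_apply, smul_eq_mul]
    ring

theorem qfi_proj {β : Type} [Fintype β] {Ψ : ℝ → β → ℂ} {Φ : β → ℂ} {θ₀ : ℝ}
    (hΨ : ∀ b, HasDerivAt (fun θ => Ψ θ b) (Φ b) θ₀) (h1 : star (Ψ θ₀) ⬝ᵥ Ψ θ₀ = 1)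
    (h0 : star (Ψ θ₀) ⬝ᵥ Φ = 0) : qfi (fun θ => proj (Ψ θ)) θ₀ = 4 * nrm Φ ^ 2 := by
  have h0' : star Φ ⬝ᵥ Ψ θ₀ = 0 := by
    rw [Matrix.star_dotProduct, h0, star_zero]
  rw [qfi_eq (isSLD_proj hΨ h1 h0 h0')]
  simp only [proj, Matrix.smul_mul, Matrix.mul_smul, Matrix.add_mul, Matrix.mul_add,
      Matrix.vecMulVec_mul_vecMulVec, h1, h0, h0', Matrix.trace_smul, Matrix.trace_add,
      Matrix.trace_vecMulVec, dotProduct_smul, star_dotProduct_self]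
  rw [dotProduct_comm (Ψ θ₀) (star (Ψ θ₀)), h1]
  simp [-Complex.ofReal_pow]
  ring

end Derivative

/-! ### The classical Fisher information of an optimal adaptive measurement -/

section Measurement

variable {ι : Type} [Fintype ι] {k : ℕ}

/-- The amplitude `⟨e_{h_1} ⊗ ⋯ ⊗ e_{h_n}| x`. -/
noncomputable def amp (E : Scheme k) (n : ℕ) (h : Fin n → Fin k) (x : ι × (Fin n → Fin k) → ℂ) :
    ι → ℂ := fun s => ∑ f, star (E.prodVec n h f) * x (s, f)

/-- The compressed operator `∑ w, conj (e w) K_w`. -/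
noncomputable def krausAlong (K : Fin k → Matrix ι ι ℂ) (e : Fin k → ℂ) : Matrix ι ι ℂ :=
  ∑ w, star (e w) • K w

theorem prodVec_snoc (E : Scheme k) (n : ℕ) (h : Fin (n + 1) → Fin k) (g : Fin n → Fin k)
    (w : Fin k) : E.prodVec (n + 1) h (Fin.snoc g w) =
      E.prodVec n (Fin.init h) g * E.vec n (Fin.init h) (h (Fin.last n)) w := by
  rw [Scheme.prodVec, Fin.prod_univ_castSucc, Fin.snoc_last]
  simp only [Fin.snoc_castSucc]
  rfl

theorem amp_add (E : Scheme k) (n : ℕ) (h : Fin n → Fin k) (x y : ι × (Fin n → Fin k) → ℂ) :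
    amp E n h (x + y) = amp E n h x + amp E n h y := by
  funext s; simp [amp, mul_add, Finset.sum_add_distrib]

theorem amp_step (E : Scheme k) (n : ℕ) (h : Fin (n + 1) → Fin k) (K : Fin k → Matrix ι ι ℂ)
    (x : ι × (Fin n → Fin k) → ℂ) :
    amp E (n + 1) h (step K x) =
      krausAlong K (E.vec n (Fin.init h) (h (Fin.last n))) *ᵥ amp E n (Fin.init h) x := by
  funext s
  simp only [amp, sum_fin_succ_fun, prodVec_snoc, step, Fin.snoc_last, Fin.init_snoc, krausAlong,
    Matrix.mulVec, dotProduct, Matrix.sum_apply, Matrix.smul_apply, smul_eq_mul, Finset.sum_mul,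
    Finset.mul_sum, star_mul']
  rw [Finset.sum_comm]
  conv_rhs => rw [Finset.sum_congr rfl fun x _ => Finset.sum_comm, Finset.sum_comm]
  refine Finset.sum_congr rfl fun w _ => ?_
  rw [Finset.sum_comm]
  exact Finset.sum_congr rfl fun _ _ => Finset.sum_congr rfl fun _ _ => by ring

theorem sandwich_mul_kronecker (e : Fin k → ℂ) (A B : Matrix (ι × Fin k) (ι × Fin k) ℂ)
    (χ : Fin k → ℂ) (X : Matrix ι ι ℂ) :
    sandwich e (A * (X ⊗ₖ proj χ) * Bᴴ) =
      krausAlong (kraus A χ) e * X * (krausAlong (kraus B χ) e)ᴴ := by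
  ext s t
  simp only [sandwich, Matrix.of_apply, mul_kronecker_proj_mul_apply, krausAlong,
    Matrix.conjTranspose_sum, Matrix.conjTranspose_smul, star_star, Finset.sum_mul,
    Finset.mul_sum, Matrix.sum_apply, Matrix.smul_mul, Matrix.mul_smul, Matrix.smul_apply,
    smul_eq_mul]
  rw [Finset.sum_comm]
  exact Finset.sum_congr rfl fun _ _ => Finset.sum_congr rfl fun _ _ => by ring

theorem sandwich_add (e : Fin k → ℂ) (M N : Matrix (ι × Fin k) (ι × Fin k) ℂ) :
    sandwich e (M + N) = sandwich e M + sandwich e N := by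
  ext; simp [sandwich, mul_add, add_mul, Finset.sum_add_distrib]

theorem sandwich_sub (e : Fin k → ℂ) (M N : Matrix (ι × Fin k) (ι × Fin k) ℂ) :
    sandwich e (M - N) = sandwich e M - sandwich e N := by
  ext; simp [sandwich, mul_sub, sub_mul, Finset.sum_sub_distrib]

theorem sandwich_smul (e : Fin k → ℂ) (c : ℂ) (M : Matrix (ι × Fin k) (ι × Fin k) ℂ) :
    sandwich e (c • M) = c • sandwich e M := by
  ext s t
  simp only [sandwich, Matrix.of_apply, Matrix.smul_apply, smul_eq_mul, Finset.mul_sum]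
  exact Finset.sum_congr rfl fun _ _ => Finset.sum_congr rfl fun _ _ => by ring

theorem trace_sandwich (e : Fin k → ℂ) (M : Matrix (ι × Fin k) (ι × Fin k) ℂ) :
    (sandwich e M).trace = star e ⬝ᵥ (traceFst M *ᵥ e) := by
  simp only [sandwich, Matrix.trace, Matrix.diag_apply, Matrix.of_apply, dotProduct, Matrix.mulVec,
    traceFst, Finset.sum_mul, Finset.mul_sum, Pi.star_apply]
  rw [Finset.sum_comm]
  refine Finset.sum_congr rfl fun _ _ => ?_
  rw [Finset.sum_comm]
  exact Finset.sum_congr rfl fun _ _ => Finset.sum_congr rfl fun _ _ => by ring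

theorem proj_tens (ψ : ι → ℂ) (χ : Fin k → ℂ) : proj (tens ψ χ) = proj ψ ⊗ₖ proj χ := by
  ext ⟨s, u⟩ ⟨t, w⟩
  simp only [proj, Matrix.vecMulVec_apply, tens, Pi.star_apply, star_mul',
    Matrix.kroneckerMap_apply]
  ring

theorem sandwich_filterStep (e : Fin k → ℂ) (W W' : Matrix (ι × Fin k) (ι × Fin k) ℂ) (ψ : ι → ℂ)
    (χ : Fin k → ℂ) (n : ℕ) (P : Matrix ι ι ℂ) :
    sandwich e (filterStep W W' ψ χ n P) =
      ((k : ℂ) ^ n)⁻¹ • (krausAlong (kraus W' χ) e * proj ψ * (krausAlong (kraus W χ) e)ᴴ -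
        krausAlong (kraus W χ) e * proj ψ * (krausAlong (kraus W' χ) e)ᴴ) +
      krausAlong (kraus W χ) e * P * (krausAlong (kraus W χ) e)ᴴ := by
  rw [filterStep, filterInit, proj_tens, sandwich_add, sandwich_smul, sandwich_sub,
    sandwich_mul_kronecker, sandwich_mul_kronecker, sandwich_mul_kronecker]

variable {W W' : Matrix (ι × Fin k) (ι × Fin k) ℂ} {ψ : ι → ℂ} {χ : Fin k → ℂ} {E : Scheme k}

theorem krausAlong_mulVec (hKψ : ∀ i, kraus W χ i *ᵥ ψ = χ i • ψ) (e : Fin k → ℂ) :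
    krausAlong (kraus W χ) e *ᵥ ψ = (star e ⬝ᵥ χ) • ψ := by
  rw [krausAlong, Matrix.sum_mulVec, dotProduct, Finset.sum_smul]
  exact Finset.sum_congr rfl fun w _ => by
    rw [Matrix.smul_mulVec, hKψ, smul_smul]; rfl

/-- Each conditioned Kraus operator has eigenvector ψ with eigenvalue ⟨e|χ⟩, of squared modulus 1/k.
Hence all records are equally likely at θ₀. -/
theorem exists_amp_totalState (hKψ : ∀ i, kraus W χ i *ᵥ ψ = χ i • ψ)
    (hE : IsOptimalScheme W W' ψ χ E) (n : ℕ) (h : Fin n → Fin k) :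
    ∃ α : ℂ, ‖α‖ ^ 2 = ((k : ℝ) ^ n)⁻¹ ∧ amp E n h (totalState W ψ χ n) = α • ψ := by
  induction n with
  | zero =>
    refine ⟨1, by simp, ?_⟩
    funext s
    simp [amp, totalState, Scheme.prodVec]
  | succ n ih =>
    obtain ⟨α, h1, h2⟩ := ih (Fin.init h)
    refine ⟨α * (star (E.vec n (Fin.init h) (h (Fin.last n))) ⬝ᵥ χ), ?_, ?_⟩
    · rw [norm_mul, mul_pow, h1, (hE n _ _).2, pow_succ, mul_inv, one_div]
    · rw [totalState_succ, amp_step, h2, Matrix.mulVec_smul, krausAlong_mulVec hKψ, smul_smul]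

theorem mul_vecMulVec_mul_conjTranspose (A B : Matrix ι ι ℂ) (v w : ι → ℂ) :
    A * Matrix.vecMulVec v (star w) * Bᴴ = Matrix.vecMulVec (A *ᵥ v) (star (B *ᵥ w)) := by
  rw [Matrix.mul_vecMulVec, Matrix.vecMulVec_mul, Matrix.star_mulVec]

/-- The weight k^{-n} |ψ⟩⟨ψ| is exactly |x̂⟩⟨x̂| for the conditioned amplitude x̂, whatever its
phase. The filter recursion is then the Leibniz rule for the conditioned amplitudes. -/
theorem filterOp_eq (hKψ : ∀ i, kraus W χ i *ᵥ ψ = χ i • ψ)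
    (hE : IsOptimalScheme W W' ψ χ E) (n : ℕ) (h : Fin n → Fin k) :
    filterOp W W' ψ χ E n h =
      Matrix.vecMulVec (amp E n h (dotState W W' ψ χ n)) (star (amp E n h (totalState W ψ χ n))) -
      Matrix.vecMulVec (amp E n h (totalState W ψ χ n))
        (star (amp E n h (dotState W W' ψ χ n))) := by
  induction n with
  | zero =>
    have : amp E 0 h (dotState W W' ψ χ 0) = 0 := by funext s; simp [amp, dotState]
    rw [this]
    ext
    simp [filterOp]
  | succ n ih =>
    obtain ⟨α, h1, h2⟩ := exists_amp_totalState hKψ hE n (Fin.init h)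
    have h3 : ((k : ℂ) ^ n)⁻¹ • proj ψ = Matrix.vecMulVec (amp E n (Fin.init h)
        (totalState W ψ χ n)) (star (amp E n (Fin.init h) (totalState W ψ χ n))) := by
      have h4 : ((k : ℂ) ^ n)⁻¹ = α * star α := by
        rw [Complex.star_def, Complex.mul_conj', ← Complex.ofReal_pow, h1]
        push_cast
        rfl
      rw [h2, h4]
      ext s t
      simp [proj, Matrix.vecMulVec_apply]
      ring
    have h5 : ∀ A B : Matrix ι ι ℂ, ((k : ℂ) ^ n)⁻¹ • (A * proj ψ * Bᴴ) =
        A * (((k : ℂ) ^ n)⁻¹ • proj ψ) * Bᴴ := fun A B => by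
      rw [Matrix.mul_smul, Matrix.smul_mul]
    rw [filterOp, sandwich_filterStep, ih, smul_sub, h5, h5, h3, Matrix.mul_sub, Matrix.sub_mul,
      mul_vecMulVec_mul_conjTranspose, mul_vecMulVec_mul_conjTranspose,
      mul_vecMulVec_mul_conjTranspose, mul_vecMulVec_mul_conjTranspose, dotState, totalState_succ,
      amp_add, amp_step, amp_step, amp_step, star_add, Matrix.add_vecMulVec, Matrix.vecMulVec_add]
    abel

/-- The trace of the filter operator is z − z̄ for the overlap z, and optimality makes it vanish. No
part of z is then lost in the derivative 2 Re z of the record's probability. -/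
theorem amp_real (hKψ : ∀ i, kraus W χ i *ᵥ ψ = χ i • ψ) (hE : IsOptimalScheme W W' ψ χ E) (n : ℕ)
    (h : Fin n → Fin k) :
    (star (amp E n h (totalState W ψ χ n)) ⬝ᵥ amp E n h (dotState W W' ψ χ n)).im = 0 := by
  have h0 : (filterOp W W' ψ χ E n h).trace = 0 := by
    cases n with
    | zero => simp [filterOp]
    | succ n => rw [filterOp, trace_sandwich]; exact (hE n _ _).1
  rw [filterOp_eq hKψ hE, Matrix.trace_sub, Matrix.trace_vecMulVec, Matrix.trace_vecMulVec,
    dotProduct_comm] at h0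
  set z := star (amp E n h (totalState W ψ χ n)) ⬝ᵥ amp E n h (dotState W W' ψ χ n) with hz
  have h1 : amp E n h (totalState W ψ χ n) ⬝ᵥ star (amp E n h (dotState W W' ψ χ n)) = star z := by
    rw [hz, Matrix.star_dotProduct, dotProduct_comm, star_star]
  rw [h1] at h0
  have := congrArg Complex.im h0
  simp at this
  linarith

/-- Parseval's identity for an adaptive measurement. -/
theorem sum_norm_sq_prodVec (E : Scheme k) (n : ℕ) (ξ : (Fin n → Fin k) → ℂ) :
    ∑ h, ‖∑ f, star (E.prodVec n h f) * ξ f‖ ^ 2 = ∑ f, ‖ξ f‖ ^ 2 := by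
  induction n with
  | zero => simp [Scheme.prodVec]
  | succ n ih =>
    rw [sum_fin_succ_fun, sum_fin_succ_fun]
    -- The last basis depends on the earlier outcomes, so the last outcome is summed first with h
    -- held fixed.
    have h1 : ∀ h : Fin n → Fin k, ∑ i, ‖∑ f, star (E.prodVec (n + 1) (Fin.snoc h i) f) * ξ f‖ ^ 2
        = ∑ w, ‖∑ g, star (E.prodVec n h g) * ξ (Fin.snoc g w)‖ ^ 2 := fun h => by
      have h2 := (E n h).sum_sq_norm_inner_right
        (WithLp.toLp 2 fun w => ∑ g, star (E.prodVec n h g) * ξ (Fin.snoc g w))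
      rw [EuclideanSpace.norm_sq_eq] at h2
      refine Eq.trans (Finset.sum_congr rfl fun i _ => ?_) h2
      congr 2
      rw [sum_fin_succ_fun, Finset.sum_comm, EuclideanSpace.inner_eq_star_dotProduct]
      simp only [dotProduct, prodVec_snoc, Fin.init_snoc, Fin.snoc_last, Finset.sum_mul]
      refine Finset.sum_congr rfl fun w _ => Finset.sum_congr rfl fun g _ => ?_
      simp only [star_mul', Scheme.vec, Pi.star_apply]
      ring
    rw [Finset.sum_congr rfl fun h _ => h1 h, Finset.sum_comm,
      Finset.sum_congr rfl fun w _ => ih fun g => ξ (Fin.snoc g w), Finset.sum_comm]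

theorem hasDerivAt_outputProb {n : ℕ} {Ψ : ℝ → ι × (Fin n → Fin k) → ℂ}
    {Φ : ι × (Fin n → Fin k) → ℂ} {θ₀ : ℝ} (hΨ : ∀ z, HasDerivAt (fun θ => Ψ θ z) (Φ z) θ₀)
    (E : Scheme k) (h : Fin n → Fin k) :
    HasDerivAt (fun θ => outputProb E (Ψ θ) h)
      (2 * (star (amp E n h (Ψ θ₀)) ⬝ᵥ amp E n h Φ).re) θ₀ := by
  have h1 : ∀ s, HasDerivAt (fun θ => amp E n h (Ψ θ) s) (amp E n h Φ s) θ₀ := fun s =>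
    HasDerivAt.fun_sum fun f _ => (hΨ (s, f)).const_mul _
  have h2 := HasDerivAt.fun_sum (u := Finset.univ) fun s (_ : s ∈ Finset.univ) => (h1 s).norm_sq
  refine h2.congr_deriv ?_
  simp only [dotProduct, Complex.re_sum, Finset.mul_sum]
  refine Finset.sum_congr rfl fun s _ => ?_
  rw [Complex.inner, mul_comm (star (amp E n h (Ψ θ₀)) s)]
  rfl

/-- With z the real overlap and p = k^{-n}, each record contributes (2z)²/p = 4|⟨ψ|ŷ⟩|², since x̂ =
αψ with |α|² = p. Parseval's identity sums these contributions. -/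
theorem cfi_outputProb (hψ : IsUnitVec ψ) (hk : k ≠ 0) (hKψ : ∀ i, kraus W χ i *ᵥ ψ = χ i • ψ)
    (hE : IsOptimalScheme W W' ψ χ E) {n : ℕ} {Ψ : ℝ → ι × (Fin n → Fin k) → ℂ} {θ₀ : ℝ}
    (hΨ : ∀ z, HasDerivAt (fun θ => Ψ θ z) (dotState W W' ψ χ n z) θ₀)
    (h0 : Ψ θ₀ = totalState W ψ χ n) :
    cfi (fun θ => outputProb E (Ψ θ)) θ₀ = 4 * nrm (coef ψ (dotState W W' ψ χ n)) ^ 2 := by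
  have hkn : (0 : ℝ) < ((k : ℝ) ^ n)⁻¹ := by positivity
  have hp : ∀ h, outputProb E (Ψ θ₀) h = ((k : ℝ) ^ n)⁻¹ := fun h => by
    obtain ⟨α, h1, h2⟩ := exists_amp_totalState hKψ hE n h
    have h3 : outputProb E (Ψ θ₀) h = ∑ s, ‖amp E n h (Ψ θ₀) s‖ ^ 2 := rfl
    have h4 : ∑ s, ‖ψ s‖ ^ 2 = 1 := by
      have := star_dotProduct_self_eq ψ
      rw [show star ψ ⬝ᵥ ψ = 1 from hψ] at this
      exact_mod_cast this.symm
    rw [h3, h0, h2]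
    simp only [Pi.smul_apply, norm_smul, mul_pow]
    rw [← Finset.mul_sum, h4, mul_one, h1]
  have hterm : ∀ h, (outputProb E (Ψ θ₀) h)⁻¹ * (deriv (fun θ => outputProb E (Ψ θ) h) θ₀) ^ 2 =
      4 * ‖∑ f, star (E.prodVec n h f) * coef ψ (dotState W W' ψ χ n) f‖ ^ 2 := fun h => by
    obtain ⟨α, h1, h2⟩ := exists_amp_totalState hKψ hE n h
    have him := amp_real hKψ hE n h
    rw [hp, (hasDerivAt_outputProb hΨ E h).deriv, h0]
    have h5 : star ψ ⬝ᵥ amp E n h (dotState W W' ψ χ n) =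
        ∑ f, star (E.prodVec n h f) * coef ψ (dotState W W' ψ χ n) f := by
      simp only [dotProduct, amp, coef, Finset.mul_sum, Pi.star_apply]
      rw [Finset.sum_comm]
      exact Finset.sum_congr rfl fun _ _ => Finset.sum_congr rfl fun _ _ => by ring
    have h6 : (star (amp E n h (totalState W ψ χ n)) ⬝ᵥ amp E n h (dotState W W' ψ χ n)).re ^ 2 =
        ((k : ℝ) ^ n)⁻¹ * ‖star ψ ⬝ᵥ amp E n h (dotState W W' ψ χ n)‖ ^ 2 := by
      set z := star (amp E n h (totalState W ψ χ n)) ⬝ᵥ amp E n h (dotState W W' ψ χ n) with hz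
      have h7 : z.re ^ 2 = ‖z‖ ^ 2 := by
        rw [Complex.sq_norm, Complex.normSq_apply, him]; ring
      rw [h7, hz, h2, star_smul, smul_dotProduct, norm_smul, norm_star, mul_pow, h1]
    rw [← h5, mul_pow, h6]
    field_simp
    ring
  have hfil : (Finset.univ.filter fun h => 0 < outputProb E (Ψ θ₀) h) = Finset.univ :=
    Finset.filter_true_of_mem fun h _ => by rw [hp]; exact hkn
  rw [cfi, hfil, Finset.sum_congr rfl fun h _ => hterm h, ← Finset.mul_sum, sum_norm_sq_prodVec,
    nrm_sq]

end Measurement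

/-! ### System and absorber -/

section Absorber

variable {d k : ℕ}

theorem doubled_apply (V A : Matrix (Fin d × Fin k) (Fin d × Fin k) ℂ) (s a t b : Fin d)
    (u w : Fin k) : doubled V A ((s, a), u) ((t, b), w) = ∑ v, V (a, u) (b, v) * A (s, v) (t, w) := by
  simp [doubled, Matrix.mul_apply, Fintype.sum_prod_type]

theorem kraus_doubled_apply (V A : Matrix (Fin d × Fin k) (Fin d × Fin k) ℂ) (χ : Fin k → ℂ)
    (s a t b : Fin d) (u : Fin k) :
    kraus (doubled V A) χ u (s, a) (t, b) = ∑ v, V (a, u) (b, v) * kraus A χ v s t := by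
  simp only [kraus, Matrix.of_apply, doubled_apply, Finset.sum_mul, Finset.mul_sum]
  rw [Finset.sum_comm]
  exact Finset.sum_congr rfl fun _ _ => Finset.sum_congr rfl fun _ _ => by ring

theorem sum_comm_four {α β γ δ ε M : Type*} [Fintype α] [Fintype β] [Fintype γ] [Fintype δ]
    [Fintype ε] [AddCommMonoid M] (F : α → β → γ → δ → ε → M) :
    ∑ a, ∑ b, ∑ c, ∑ x, ∑ y, F a b c x y = ∑ b, ∑ c, ∑ x, ∑ y, ∑ a, F a b c x y := by
  rw [Finset.sum_comm]
  refine Finset.sum_congr rfl fun b _ => ?_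
  rw [Finset.sum_comm]
  refine Finset.sum_congr rfl fun c _ => ?_
  rw [Finset.sum_comm]
  refine Finset.sum_congr rfl fun x _ => ?_
  rw [Finset.sum_comm]

theorem sum_mul_star_of_unitary {V : Matrix (Fin d × Fin k) (Fin d × Fin k) ℂ}
    (hV : V ∈ Matrix.unitaryGroup (Fin d × Fin k) ℂ) (b b' : Fin d) (v v' : Fin k) :
    ∑ a, ∑ u, V (a, u) (b, v) * star (V (a, u) (b', v')) =
      if b' = b then (if v' = v then 1 else 0) else 0 := by
  have h := congrFun (congrFun (Matrix.mem_unitaryGroup_iff'.1 hV) (b', v')) (b, v)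
  rw [Matrix.mul_apply, Fintype.sum_prod_type, Matrix.one_apply] at h
  simp only [Prod.mk.injEq, ite_and] at h
  rw [← h]
  exact Finset.sum_congr rfl fun _ _ => Finset.sum_congr rfl fun _ _ => mul_comm _ _

/-- The reduced dynamics of the system does not see the absorber. -/
theorem traceSnd_crossMap_doubled {V : Matrix (Fin d × Fin k) (Fin d × Fin k) ℂ}
    (hV : V ∈ Matrix.unitaryGroup (Fin d × Fin k) ℂ)
    (A B : Matrix (Fin d × Fin k) (Fin d × Fin k) ℂ) (χ : Fin k → ℂ)
    (X : Matrix (Fin d × Fin d) (Fin d × Fin d) ℂ) :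
    traceSnd (crossMap (kraus (doubled V A) χ) (kraus (doubled V B) χ) X) =
      crossMap (kraus A χ) (kraus B χ) (traceSnd X) := by
  ext s s'
  have h1 : traceSnd (crossMap (kraus (doubled V A) χ) (kraus (doubled V B) χ) X) s s' =
      ∑ a, ∑ u, ∑ z : Fin d × Fin d, ∑ y : Fin d × Fin d, ∑ v, ∑ v',
        kraus A χ v s y.1 * X y z * star (kraus B χ v' s' z.1) *
          (V (a, u) (y.2, v) * star (V (a, u) (z.2, v'))) := by
    simp only [traceSnd, Matrix.of_apply, crossMap_apply, Matrix.sum_apply, Matrix.mul_apply,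
      Matrix.conjTranspose_apply]
    refine Finset.sum_congr rfl fun a _ => Finset.sum_congr rfl fun u _ =>
      Finset.sum_congr rfl fun z _ => ?_
    rw [Finset.sum_mul]
    refine Finset.sum_congr rfl fun y _ => ?_
    obtain ⟨t, b⟩ := y
    obtain ⟨t', b'⟩ := z
    rw [kraus_doubled_apply, kraus_doubled_apply, star_sum, Finset.sum_mul, Finset.sum_mul]
    refine Finset.sum_congr rfl fun v _ => ?_
    rw [Finset.mul_sum]
    refine Finset.sum_congr rfl fun v' _ => ?_
    rw [star_mul']
    ring
  -- The sums over (a, u) are brought innermost, where unitarity of V identifies b with b' and v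
  -- with v'.
  rw [h1, Finset.sum_congr rfl fun a _ => sum_comm_four _, sum_comm_four]
  simp only [← Finset.mul_sum, sum_mul_star_of_unitary hV]
  simp only [Fintype.sum_prod_type, mul_ite, mul_one, mul_zero, Finset.sum_ite_eq, Finset.sum_ite_eq',
    Finset.sum_ite_irrel, Finset.sum_const_zero, Finset.mem_univ, if_true]
  simp only [traceSnd, Matrix.of_apply, crossMap_apply, Matrix.sum_apply, Matrix.mul_apply,
      Matrix.conjTranspose_apply, Finset.sum_mul, Finset.mul_sum]
  symm
  rw [Finset.sum_comm]
  refine Finset.sum_congr rfl fun t' _ => ?_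
  rw [Finset.sum_congr rfl fun c _ => Finset.sum_comm, Finset.sum_comm]
  refine Finset.sum_congr rfl fun b _ => ?_
  rw [Finset.sum_comm]

theorem trace_traceSnd {ι κ : Type} [Fintype ι] [Fintype κ] (X : Matrix (ι × κ) (ι × κ) ℂ) :
    (traceSnd X).trace = X.trace := by
  simp [traceSnd, Matrix.trace, Fintype.sum_prod_type]

theorem traceSnd_add {ι κ : Type} [Fintype κ] (X Y : Matrix (ι × κ) (ι × κ) ℂ) :
    traceSnd (X + Y) = traceSnd X + traceSnd Y := by
  ext; simp [traceSnd, Finset.sum_add_distrib]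

theorem traceSnd_proj {ι κ : Type} [Fintype κ] (ψ : ι × κ → ℂ) :
    traceSnd (proj ψ) = gram ψ ψ := by
  ext; simp [traceSnd, proj, gram, Matrix.vecMulVec_apply]

theorem mulVec_tens_apply {ι κ : Type} [Fintype ι] [Fintype κ]
    (M : Matrix (ι × κ) (ι × κ) ℂ) (ψ : ι → ℂ) (χ : κ → ℂ) (s : ι) (i : κ) :
    (M *ᵥ tens ψ χ) (s, i) = (kraus M χ i *ᵥ ψ) s := by
  simp only [Matrix.mulVec, dotProduct, Fintype.sum_prod_type, tens, kraus, Matrix.of_apply,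
    Finset.sum_mul]
  exact Finset.sum_congr rfl fun _ _ => Finset.sum_congr rfl fun _ _ => by ring

theorem trace_mul_proj {ι : Type} [Fintype ι] (A : Matrix ι ι ℂ) (ψ : ι → ℂ) :
    (A * proj ψ).trace = star ψ ⬝ᵥ (A *ᵥ ψ) := by
  rw [proj, Matrix.mul_vecMulVec, Matrix.trace_vecMulVec, dotProduct_comm]

theorem kraus_mulVec_of_fixed {ι κ : Type} [Fintype ι] [Fintype κ]
    {W : Matrix (ι × κ) (ι × κ) ℂ} {ψ : ι → ℂ} {χ : κ → ℂ}
    (h : W *ᵥ tens ψ χ = tens ψ χ) (i : κ) : kraus W χ i *ᵥ ψ = χ i • ψ := by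
  funext s
  rw [← mulVec_tens_apply, h, tens, Pi.smul_apply, smul_eq_mul, mul_comm]

/-- As W fixes ψ ⊗ χ, the Kraus operators of W merely supply the bra ⟨ψ ⊗ χ|. The phase convention
thereby makes the drive of η_n traceless. -/
theorem trace_crossMap_proj {ι κ : Type} [Fintype ι] [Fintype κ]
    {W W' : Matrix (ι × κ) (ι × κ) ℂ} {ψ : ι → ℂ} {χ : κ → ℂ}
    (h : W *ᵥ tens ψ χ = tens ψ χ) :
    (crossMap (kraus W' χ) (kraus W χ) (proj ψ)).trace =
      star (tens ψ χ) ⬝ᵥ (W' *ᵥ tens ψ χ) := by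
  rw [trace_crossMap, trace_mul_proj, Matrix.sum_mulVec, dotProduct_sum]
  conv_rhs => rw [dotProduct, Fintype.sum_prod_type, Finset.sum_comm]
  refine Finset.sum_congr rfl fun i _ => ?_
  rw [← Matrix.mulVec_mulVec, Matrix.dotProduct_mulVec, ← Matrix.star_mulVec,
    kraus_mulVec_of_fixed h, dotProduct]
  refine Finset.sum_congr rfl fun s _ => ?_
  rw [mulVec_tens_apply]
  simp [tens, mul_comm]

theorem hasDerivAt_doubled {U : ℝ → Matrix (Fin d × Fin k) (Fin d × Fin k) ℂ}
    {U' : Matrix (Fin d × Fin k) (Fin d × Fin k) ℂ} {θ₀ : ℝ}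
    (hU : ∀ a b, HasDerivAt (fun θ => U θ a b) (U' a b) θ₀)
    (V : Matrix (Fin d × Fin k) (Fin d × Fin k) ℂ) (a b : (Fin d × Fin d) × Fin k) :
    HasDerivAt (fun θ => doubled V (U θ) a b) (doubled V U' a b) θ₀ := by
  obtain ⟨⟨s, a⟩, u⟩ := a
  obtain ⟨⟨t, b⟩, w⟩ := b
  simp only [doubled_apply]
  exact HasDerivAt.fun_sum fun v _ => (hU _ _).const_mul _

theorem conjTranspose_mul_deriv_add {ι : Type} [Fintype ι] [DecidableEq ι]
    {U : ℝ → Matrix ι ι ℂ} (hU : ∀ θ, U θ ∈ Matrix.unitaryGroup ι ℂ) {U' : Matrix ι ι ℂ} {θ₀ : ℝ}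
    (hd : ∀ a b, HasDerivAt (fun θ => U θ a b) (U' a b) θ₀) :
    U'ᴴ * U θ₀ + (U θ₀)ᴴ * U' = 0 := by
  ext a b
  have h1 : HasDerivAt (fun θ => ((U θ)ᴴ * U θ) a b) ((U'ᴴ * U θ₀ + (U θ₀)ᴴ * U') a b) θ₀ := by
    simp only [Matrix.mul_apply, Matrix.add_apply, Matrix.conjTranspose_apply,
      ← Finset.sum_add_distrib]
    exact HasDerivAt.fun_sum fun c _ => (hd c a).star.mul (hd c b)
  have h2 : (fun θ => ((U θ)ᴴ * U θ) a b) = fun _ => (1 : Matrix ι ι ℂ) a b := by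
    funext θ
    have h : (U θ)ᴴ * U θ = 1 := Matrix.mem_unitaryGroup_iff'.1 (hU θ)
    rw [h]
  rw [h2] at h1
  exact h1.unique (hasDerivAt_const _ _)

/-- Partial expectation in χ of the differentiated unitarity relation. -/
theorem sum_conjTranspose_kraus_deriv_mul_kraus {ι κ : Type} [Fintype ι] [Fintype κ]
    {A B : Matrix (ι × κ) (ι × κ) ℂ} (h : Aᴴ * B + Bᴴ * A = 0) (χ : κ → ℂ) :
    (∑ i, (kraus A χ i)ᴴ * kraus B χ i)ᴴ = -∑ i, (kraus A χ i)ᴴ * kraus B χ i := by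
  rw [eq_neg_iff_add_eq_zero, Matrix.conjTranspose_sum]
  simp only [Matrix.conjTranspose_mul, Matrix.conjTranspose_conjTranspose]
  ext s t
  rw [Matrix.add_apply, sum_conjTranspose_kraus_mul_kraus, sum_conjTranspose_kraus_mul_kraus,
    ← Finset.sum_add_distrib]
  refine Finset.sum_eq_zero fun u _ => ?_
  rw [← Finset.sum_add_distrib]
  refine Finset.sum_eq_zero fun w _ => ?_
  have h1 := congrFun (congrFun h (s, u)) (t, w)
  rw [Matrix.add_apply, Matrix.zero_apply] at h1
  linear_combination star (χ u) * χ w * h1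

end Absorber

/-! ### The joint state of system, absorber and output -/

section Joint

variable {ι κ : Type} [Fintype ι] [Fintype κ]
  {W W' : Matrix (ι × κ) (ι × κ) ℂ} {ψ : ι → ℂ} {χ : κ → ℂ}

theorem gram_totalState (h : crossMap (kraus W χ) (kraus W χ) (proj ψ) = proj ψ) (n : ℕ) :
    gram (totalState W ψ χ n) (totalState W ψ χ n) = proj ψ := by
  induction n with
  | zero => ext; simp [gram, totalState, proj, Matrix.vecMulVec_apply]
  | succ n ih => rw [totalState_succ, gram_step, ih, h]

theorem gram_dotState_totalState_succ
    (h : crossMap (kraus W χ) (kraus W χ) (proj ψ) = proj ψ) (n : ℕ) :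
    gram (dotState W W' ψ χ (n + 1)) (totalState W ψ χ (n + 1)) =
      crossMap (kraus W' χ) (kraus W χ) (proj ψ) +
        crossMap (kraus W χ) (kraus W χ) (gram (dotState W W' ψ χ n) (totalState W ψ χ n)) := by
  rw [dotState, totalState_succ, gram_add_left, gram_step, gram_step, gram_totalState h]

theorem gram_dotState_succ (h : crossMap (kraus W χ) (kraus W χ) (proj ψ) = proj ψ) (n : ℕ) :
    gram (dotState W W' ψ χ (n + 1)) (dotState W W' ψ χ (n + 1)) =
      crossMap (kraus W' χ) (kraus W' χ) (proj ψ) +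
      (crossMap (kraus W χ) (kraus W' χ) (gram (dotState W W' ψ χ n) (totalState W ψ χ n)))ᴴ +
      crossMap (kraus W χ) (kraus W' χ) (gram (dotState W W' ψ χ n) (totalState W ψ χ n)) +
      crossMap (kraus W χ) (kraus W χ) (gram (dotState W W' ψ χ n) (dotState W W' ψ χ n)) := by
  rw [dotState, gram_add_left, gram_add_right, gram_add_right, gram_step, gram_step, gram_step,
    gram_step, gram_totalState h, crossMap_conjTranspose, gram_conjTranspose]
  abel

end Joint

/-! ### Linear growth up to a bounded error, and the main theorem -/

theorem tendsto_div_of_abs_sub_le {u : ℕ → ℝ} {f C : ℝ} (h : ∀ n : ℕ, |u n - n * f| ≤ C) :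
    Tendsto (fun n : ℕ => u n / n) atTop (𝓝 f) := by
  rw [tendsto_iff_norm_sub_tendsto_zero]
  refine squeeze_zero' (Eventually.of_forall fun _ => norm_nonneg _) ?_
    (tendsto_const_div_atTop_nhds_zero_nat C)
  filter_upwards [eventually_gt_atTop 0] with n hn
  have hn' : (0 : ℝ) < n := by exact_mod_cast hn
  have : u n / n - f = (u n - n * f) / n := by field_simp
  rw [this, Real.norm_eq_abs, abs_div, abs_of_pos hn']
  exact div_le_div_of_nonneg_right (h n) hn'.le

end QMC

theorem proposition1 {d k : ℕ}
    -- the input-output model: smooth family of unitaries, noise units prepared in state `χ`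
    (U : ℝ → Matrix (Fin d × Fin k) (Fin d × Fin k) ℂ)
    (hU : ∀ θ, U θ ∈ Matrix.unitaryGroup (Fin d × Fin k) ℂ)
    (hUsmooth : ∀ a b, ContDiff ℝ ∞ (fun θ => U θ a b))
    (χ : Fin k → ℂ) (hχ : QMC.IsUnitVec χ) (θ₀ : ℝ)
    -- the chain is primitive at `θ₀`
    (ρss : Matrix (Fin d) (Fin d) ℂ)
    (hprim : QMC.IsPrimitive (QMC.transition (U θ₀) χ) ρss)
    -- the absorber: at `θ₀` system + absorber form an ergodic chain with pure stationary state `ψ`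
    (V : Matrix (Fin d × Fin k) (Fin d × Fin k) ℂ)
    (hV : V ∈ Matrix.unitaryGroup (Fin d × Fin k) ℂ)
    (ψ : Fin d × Fin d → ℂ) (hψ : QMC.IsUnitVec ψ)
    (habs : QMC.doubled V (U θ₀) *ᵥ QMC.tens ψ χ = QMC.tens ψ χ)
    (herg : QMC.IsUniqueStationaryState
      (QMC.transition (QMC.doubled V (U θ₀)) χ) (QMC.proj ψ))
    -- the phase convention `⟨ψ⊗χ| Ẇ |ψ⊗χ⟩ = 0`
    (hphase : star (QMC.tens ψ χ) ⬝ᵥ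
      (QMC.matDeriv (fun θ => QMC.doubled V (U θ)) θ₀ *ᵥ QMC.tens ψ χ) = 0)
    -- the Moore-Penrose inverse of `Id - T` (Heisenberg picture)
    (R : Module.End ℂ (Matrix (Fin d) (Fin d) ℂ))
    (hR : QMC.IsMoorePenrose (1 - QMC.dualTransition (U θ₀) χ) R) :
    (∃ c : ℝ, ∀ E : QMC.Scheme k,
      QMC.IsOptimalScheme (QMC.doubled V (U θ₀))
        (QMC.matDeriv (fun θ => QMC.doubled V (U θ)) θ₀) ψ χ E →
      ∀ n : ℕ, QMC.totalQFI U V ψ χ θ₀ n - QMC.outputCFI U V ψ χ E θ₀ n < c) ∧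
    (∀ E : QMC.Scheme k,
      QMC.IsOptimalScheme (QMC.doubled V (U θ₀))
        (QMC.matDeriv (fun θ => QMC.doubled V (U θ)) θ₀) ψ χ E →
      Tendsto (fun n : ℕ => QMC.outputCFI U V ψ χ E θ₀ n / n) atTop
        (𝓝 (QMC.qfiRate (U θ₀) (QMC.matDeriv U θ₀) χ ρss R))) ∧
    Tendsto (fun n : ℕ => QMC.totalQFI U V ψ χ θ₀ n / n) atTop
      (𝓝 (QMC.qfiRate (U θ₀) (QMC.matDeriv U θ₀) χ ρss R)) ∧
    0 ≤ QMC.qfiRate (U θ₀) (QMC.matDeriv U θ₀) χ ρss R ∧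
    (¬ BddAbove (Set.range fun n : ℕ => QMC.totalQFI U V ψ χ θ₀ n) →
      0 < QMC.qfiRate (U θ₀) (QMC.matDeriv U θ₀) χ ρss R) := by
  have hd : ∀ a b, HasDerivAt (fun θ => U θ a b) (QMC.matDeriv U θ₀ a b) θ₀ := fun a b =>
    ((hUsmooth a b).differentiable (by simp)).differentiableAt.hasDerivAt
  set U' := QMC.matDeriv U θ₀ with hU'
  have hWd := QMC.hasDerivAt_doubled hd V
  have hW' : QMC.matDeriv (fun θ => QMC.doubled V (U θ)) θ₀ = QMC.doubled V U' := by
    ext a b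
    exact (hWd a b).deriv
  rw [hW'] at hphase ⊢
  set W := QMC.doubled V (U θ₀) with hW
  set W' := QMC.doubled V U' with hW''
  -- isometry relations
  have hk := QMC.sum_kraus_isometry (hU θ₀) hχ
  -- Trace preservation is read off on the system marginal, where V has dropped out; testing against
  -- all X then gives the isometry relation for the Kraus operators of W.
  have htrW : ∀ X, (QMC.crossMap (QMC.kraus W χ) (QMC.kraus W χ) X).trace = X.trace := fun X => by
    rw [← QMC.trace_traceSnd, hW, QMC.traceSnd_crossMap_doubled hV, QMC.trace_crossMap, hk,
      one_mul, QMC.trace_traceSnd]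
  have hK : ∑ i, (QMC.kraus W χ i)ᴴ * QMC.kraus W χ i = 1 := by
    refine Matrix.ext_iff_trace_mul_right.2 fun X => ?_
    rw [← QMC.trace_crossMap, htrW, one_mul]
  have hKψ := QMC.kraus_mulVec_of_fixed habs
  rw [QMC.transition_eq_crossMap] at herg
  have hfix := herg.2.1
  -- the reduced stationary state
  have hρ : QMC.traceSnd (QMC.proj ψ) = ρss := by
    refine hprim.1.2.2 _ ⟨?_, ?_⟩ ?_
    · rw [QMC.traceSnd_proj]; exact QMC.gram_self_posSemidef ψ
    · rw [QMC.trace_traceSnd, QMC.trace_proj]; exact hψ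
    · rw [QMC.transition_eq_crossMap, ← QMC.traceSnd_crossMap_doubled hV, ← hW, hfix]
  -- the sequence of derivatives
  set x := QMC.totalState W ψ χ with hx
  set y := QMC.dotState W W' ψ χ with hy
  set η : ℕ → Matrix (Fin d) (Fin d) ℂ := fun n => QMC.traceSnd (QMC.gram (y n) (x n)) with hη
  set L := QMC.kraus U' χ with hL
  have hη0 : η 0 = 0 := by
    ext s t; simp [hη, hy, QMC.dotState, QMC.traceSnd, QMC.gram]
  have hηs : ∀ n, η (n + 1) = QMC.crossMap L (QMC.kraus (U θ₀) χ) ρss +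
      QMC.transition (U θ₀) χ (η n) := fun n => by
    simp only [hη, hy, hx]
    rw [QMC.gram_dotState_totalState_succ hfix, QMC.traceSnd_add, hW, hW'',
      QMC.traceSnd_crossMap_doubled hV, QMC.traceSnd_crossMap_doubled hV, hρ,
      QMC.transition_eq_crossMap]
  have hY : (QMC.crossMap L (QMC.kraus (U θ₀) χ) ρss).trace = 0 := by
    rw [← hρ, hL, ← QMC.traceSnd_crossMap_doubled hV, QMC.trace_traceSnd, ← hphase, ← hW, ← hW'']
    exact QMC.trace_crossMap_proj habs
  have hηtr : ∀ n, (η n).trace = 0 := fun n => by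
    induction n with
    | zero => rw [hη0, Matrix.trace_zero]
    | succ n ih => rw [hηs, Matrix.trace_add, hY, QMC.trace_transition hk, ih, add_zero]
  -- quantum Fisher information
  have hF : ∀ n, QMC.totalQFI U V ψ χ θ₀ n = 4 * QMC.nrm (y n) ^ 2 := fun n => by
    refine QMC.qfi_proj (fun b => QMC.hasDerivAt_totalState hWd ψ χ n b) ?_ ?_
    · rw [← QMC.trace_gram, QMC.gram_totalState hfix, QMC.trace_proj]; exact hψ
    · rw [← QMC.trace_gram, ← QMC.trace_traceSnd]; exact hηtr n
  have hk0 : k ≠ 0 := by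
    rintro rfl
    simp [QMC.IsUnitVec] at hχ
  have hI : ∀ E : QMC.Scheme k, QMC.IsOptimalScheme W W' ψ χ E → ∀ n,
      QMC.outputCFI U V ψ χ E θ₀ n = 4 * QMC.nrm (QMC.coef ψ (y n)) ^ 2 := fun E hE n =>
    QMC.cfi_outputProb hψ hk0 hKψ hE (fun z => QMC.hasDerivAt_totalState hWd ψ χ n z) rfl
  have hFI : ∀ E : QMC.Scheme k, QMC.IsOptimalScheme W W' ψ χ E → ∀ n,
      QMC.totalQFI U V ψ χ θ₀ n - QMC.outputCFI U V ψ χ E θ₀ n =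
        4 * QMC.nrm (QMC.perp ψ (y n)) ^ 2 := fun E hE n => by
    rw [hF, hI E hE, QMC.nrm_perp_sq hψ]; ring
  -- the component orthogonal to `ψ` is bounded
  obtain ⟨C, hC⟩ : ∃ C, ∀ n, QMC.nrm (QMC.perp ψ (y n)) ≤ C := by
    refine QMC.exists_nrm_perp_le hK hψ hKψ herg y
      (fun n => match n with
        | 0 => 0
        | n + 1 => QMC.step (QMC.kraus W' χ) (x n)) (fun n => rfl)
      (c := Real.sqrt (QMC.crossMap (QMC.kraus W' χ) (QMC.kraus W' χ) (QMC.proj ψ)).trace.re)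
      fun n => Real.le_sqrt_of_sq_le (le_of_eq ?_)
    rw [← QMC.gram_totalState hfix n, ← QMC.gram_step, QMC.trace_gram_self, Complex.ofReal_re]
  have hC2 : ∀ n, 4 * QMC.nrm (QMC.perp ψ (y n)) ^ 2 ≤ 4 * C ^ 2 := fun n => by
    have := pow_le_pow_left₀ (QMC.nrm_nonneg _) (hC n) 2
    linarith
  -- linear growth
  set B := ∑ i, (L i)ᴴ * QMC.kraus (U θ₀) χ i with hB
  have hBanti : Bᴴ = -B := QMC.sum_conjTranspose_kraus_deriv_mul_kraus
    (QMC.conjTranspose_mul_deriv_add hU hd) χ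
  obtain ⟨D, hD⟩ := QMC.exists_sum_re_trace_sub_le hR hk hprim.1 L hBanti hY η hη0 hηs
  set a : ℝ := ∑ i, (ρss * ((L i)ᴴ * L i)).trace.re with ha
  -- The two cross terms are adjoint to each other, whence twice a real part, and both only see the
  -- system marginal.
  have hstep : ∀ n, QMC.nrm (y (n + 1)) ^ 2 =
      QMC.nrm (y n) ^ 2 + (a + 2 * (B * η n).trace.re) := fun n => by
    have h1 := congrArg (fun X => X.trace.re) (QMC.gram_dotState_succ (W' := W') hfix n)
    simp only [Matrix.trace_add, Matrix.trace_conjTranspose, Complex.add_re] at h1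
    rw [QMC.trace_gram_self, htrW, QMC.trace_gram_self, Complex.ofReal_re, Complex.ofReal_re] at h1
    have h2 : (QMC.crossMap (QMC.kraus W χ) (QMC.kraus W' χ)
        (QMC.gram (y n) (x n))).trace = (B * η n).trace := by
      rw [← QMC.trace_traceSnd, hW, hW'', QMC.traceSnd_crossMap_doubled hV, QMC.trace_crossMap]
    have h3 : (QMC.crossMap (QMC.kraus W' χ) (QMC.kraus W' χ) (QMC.proj ψ)).trace.re = a := by
      rw [← QMC.trace_traceSnd, hW'', QMC.traceSnd_crossMap_doubled hV, QMC.trace_crossMap, hρ, ha,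
        Matrix.trace_mul_comm, Finset.mul_sum, Matrix.trace_sum, Complex.re_sum]
    rw [h2, h3] at h1
    rw [h1]
    simp
    ring
  have hN : ∀ n : ℕ, QMC.nrm (y n) ^ 2 =
      n * a + 2 * ∑ m ∈ Finset.range n, (B * η m).trace.re := fun n => by
    induction n with
    | zero => simp [QMC.nrm_sq, hy, QMC.dotState]
    | succ n ih =>
      rw [hstep, ih, Finset.sum_range_succ]
      push_cast
      ring
  set f := QMC.qfiRate (U θ₀) U' χ ρss R with hf
  have hfe : f = 4 * (a + 2 * ∑ i, (QMC.imPart (QMC.kraus (U θ₀) χ i * ρss * (L i)ᴴ) *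
      R (QMC.imPart B)).trace.re) := by
    rw [hf, QMC.qfiRate, Finset.sum_add_distrib, ← Finset.mul_sum]
  -- 8 = 4 · 2: the factor in F = 4‖y‖² times the two cross terms.
  have hlin : ∀ n : ℕ, |QMC.totalQFI U V ψ χ θ₀ n - n * f| ≤ 8 * D := fun n => by
    rw [hF, hN, hfe]
    have h := abs_le.1 (hD n)
    rw [abs_le]
    constructor <;> nlinarith [h.1, h.2]
  have hlinI : ∀ E : QMC.Scheme k, QMC.IsOptimalScheme W W' ψ χ E → ∀ n : ℕ,
      |QMC.outputCFI U V ψ χ E θ₀ n - n * f| ≤ 8 * D + 4 * C ^ 2 := fun E hE n => by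
    have h1 := abs_le.1 (hlin n)
    have h2 := hFI E hE n
    have h3 := hC2 n
    have h4 := sq_nonneg (QMC.nrm (QMC.perp ψ (y n)))
    rw [abs_le]
    constructor <;> linarith [h1.1, h1.2, sq_nonneg C]
  have hlim := QMC.tendsto_div_of_abs_sub_le hlin
  have hf0 : 0 ≤ f := ge_of_tendsto' hlim fun n => by rw [hF]; positivity
  refine ⟨⟨4 * C ^ 2 + 1, fun E hE n => ?_⟩,
    fun E hE => QMC.tendsto_div_of_abs_sub_le (hlinI E hE), hlim, hf0, fun hb => ?_⟩
  · rw [hFI E hE]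
    linarith [hC2 n]
  -- If f were 0, the bounded deviation from n f would itself bound F.
  · refine lt_of_le_of_ne hf0 fun h0 => hb ⟨8 * D, ?_⟩
    rintro _ ⟨n, rfl⟩
    have := (abs_le.1 (hlin n)).2
    rw [← h0, mul_zero, sub_zero] at this
    exact this
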